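/- **Ensemble.** Let $n d_v = m d_c$. Give each of $n$ variables $d_v$ sockets and each of $m$ checks $d_c$ sockets, and match the $nd_v$ left sockets with the $md_c$ right sockets by a uniformly random bijection. Join variable $v$ and check $j$ in the parity-check graph iff an odd number of socket edges runs between them; let $N(j)$ be the set of neighbours of $j$. The random $(d_v,d_c)$-LDPC code is $\{c\in\mathbb F_2^n:\sum_{v\in N(j)}c_v=0 \text{ for all } j\}$. "With high probability" means with probability tending to $1$ as $n\to\infty$ (over $n$ with $d_c\mid nd_v$), for fixed $d_v,d_c$. **Sherali-Adams.** Given a received vector $s\in\mathbb F_2^n$ and an integer $t$ with $1\le t\le n$ and $t\ge |N(j)|$ for all $j$, a feasible solution to $t$ rounds of Sherali-Adams is a family $X_S(\alpha)\in[0,1]$ ($S\subseteq[n]$, $|S|\le t$, $\alpha:S\to\{0,1\}$) with $X_\emptyset=1$, with $\sum_{\gamma:T\to\{0,1\},\,\gamma|_S=\alpha}X_T(\gamma)=X_S(\alpha)$ whenever $S\subseteq T$, $|T|\le t$, and with $X_{N(j)}(\alpha)=0$ for every check $j$ and every $\alpha:N(j)\to\{0,1\}$ for which $|\{v:\alpha(v)=1\}|\not\equiv\sum_{v\in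 N(j)}s_v \pmod 2$. Its value is $\frac1n\sum_v X_{\{v\}}(1)$. The decoder based on $t$ rounds succeeds on the transmitted codeword $c$ and received vector $s$ iff the integral solution given by the flip pattern $s+c$ is the unique feasible solution of minimum value. **Theorem.** Let $d_c\ge5$, and let $b=\frac1{d_c-3}$ if $d_c$ is odd and $b=\frac1{d_c-4}$ if $d_c$ is even. There is $\eta>0$, depending only on $d_c$, such that for every $d_v\le d_c$ (equivalently, $m\le n$) a random $(d_v,d_c)$-LDPC code satisfies the following with high probability. For every received vector $s\in\mathbb F_2^n$: 1. $\lfloor\eta n\rfloor$ rounds of Sherali-Adams have a feasible solution with $X_{\{v\}}(1)=b$ for every $v$, hence of value $b$; 2. for every codeword $c$ at Hamming distance at least $bn$ from $s$, the decoder based on $\lfloor\eta n\rfloor$ rounds fails when $c$ is transmitted and $s$ is received. For arbitrary $d_v$ (also $d_v>d_c$) the same holds with some $\eta>0$ that may depend on $d_v$ as well as on $d_c$. -/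

import Mathlib

open Finset

noncomputable section

namespace SALDPC

/-! ### The random ensemble -/

/-- An outcome of the socket model: each of the `n` variables carries `dv` sockets, each of the `m`
checks carries `dc` sockets, and the left sockets are matched bijectively with the right ones. -/
abbrev SocketMatching (n m dv dc : ℕ) : Type :=
  (Fin n × Fin dv) ≃ (Fin m × Fin dc)

/-- The parity-check graph of a code with `n` variables and `m` checks: `N j` is the set of
variables adjacent to the check `j`. -/
abbrev ParityCheckGraph (n m : ℕ) : Type := Fin m → Finset (Fin n)

/-- The graph of a socket matching: variable `v` and check `j` are adjacent iff an odd number of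
socket edges joins them. -/
def SocketMatching.graph {n m dv dc : ℕ} (π : SocketMatching n m dv dc) : ParityCheckGraph n m :=
  fun j => {v | Odd #{a : Fin dv | (π (v, a)).1 = j}}

/-- The probability of the event `E` under the uniform distribution on the finite type `Ω`. -/
def uniformProb {Ω : Type*} (E : Ω → Prop) : ℝ :=
  (Nat.card {ω : Ω // E ω} : ℝ) / (Nat.card Ω : ℝ)

/-- A property of the parity-check graph holds with high probability for a random
`(dv, dc)`-LDPC code: its probability tends to `1` as the block length `n` tends to infinity along
the integers for which the number of checks `m = n * dv / dc` is an integer. -/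
def WithHighProbability (dv dc : ℕ) (P : ∀ n m : ℕ, ParityCheckGraph n m → Prop) : Prop :=
  ∀ ε : ℝ, 0 < ε → ∃ n₀ : ℕ, ∀ n m : ℕ, n₀ ≤ n → n * dv = m * dc →
    1 - ε ≤ uniformProb fun π : SocketMatching n m dv dc => P n m π.graph

/-! ### Constraint satisfaction problems and the Sherali-Adams hierarchy -/

/-- An instance of a constraint satisfaction problem with variables `V`, domain `G` and constraints
indexed by `ι`: each constraint has a scope (a variable occurs at most once in it) and a predicate
on the partial assignments to its scope. -/
structure CSPInstance (V G ι : Type*) where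
  scope : ι → Finset V
  pred : ∀ i : ι, (scope i → G) → Prop

section SheraliAdams

variable {V G ι : Type*} [Fintype V] [DecidableEq V] [Fintype G] [DecidableEq G]

/-- `X` is a `t`-local distribution. Only the values `X S α` with `|S| ≤ t` matter. The sum in
`marginal` runs over all extensions `γ : T → G` of `α : S → G`. -/
structure IsLocalDistribution (t : ℕ) (X : (S : Finset V) → (S → G) → ℝ) : Prop where
  mem_Icc : ∀ S : Finset V, #S ≤ t → ∀ α : S → G, X S α ∈ Set.Icc (0 : ℝ) 1
  empty : ∀ α : (∅ : Finset V) → G, X ∅ α = 1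
  marginal : ∀ (S T : Finset V) (h : S ⊆ T), #T ≤ t → ∀ α : S → G,
    ∑ γ : T → G with (∀ v : S, γ ⟨v.1, h v.2⟩ = α v), X T γ = X S α

/-- `X` is a feasible point of the linear program of `t` rounds of the Sherali-Adams hierarchy for
`I` (`1 ≤ t ≤ |V|` and `t` is at least every arity): a `t`-local distribution that satisfies every
constraint, i.e. is supported on satisfying partial assignments on each scope. -/
structure IsSAFeasible (I : CSPInstance V G ι) (t : ℕ)
    (X : (S : Finset V) → (S → G) → ℝ) : Prop where
  one_le : 1 ≤ t
  le_card : t ≤ Fintype.card V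
  arity_le : ∀ i : ι, #(I.scope i) ≤ t
  isLocal : IsLocalDistribution t X
  satisfies : ∀ (i : ι) (α : I.scope i → G), ¬ I.pred i α → X (I.scope i) α = 0

/-- The local distribution of an integral assignment `f`. -/
def integralSolution (f : V → G) (S : Finset V) (α : S → G) : ℝ :=
  if ∀ v : S, α v = f v then 1 else 0

end SheraliAdams

section MinOnes

variable {V ι : Type*} [Fintype V] [DecidableEq V]

/-- `X_v(1)`. -/
def probOne (X : (S : Finset V) → (S → ZMod 2) → ℝ) (v : V) : ℝ := X {v} fun _ => 1

/-- The objective of the relaxation: the normalized expected number of variables equal to `1`. -/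
def saValue (X : (S : Finset V) → (S → ZMod 2) → ℝ) : ℝ :=
  (∑ v : V, probOne X v) / (Fintype.card V : ℝ)

/-- The integral assignment `f` is the unique optimum of `t` rounds of Sherali-Adams for the
Min-Ones instance `I`. -/
def IsUniqueSAOptimum (I : CSPInstance V (ZMod 2) ι) (t : ℕ) (f : V → ZMod 2) : Prop :=
  IsSAFeasible I t (integralSolution f) ∧
    ∀ X : (S : Finset V) → (S → ZMod 2) → ℝ, IsSAFeasible I t X →
      saValue (integralSolution f) ≤ saValue X ∧
        (saValue X = saValue (integralSolution f) →
          ∀ S : Finset V, #S ≤ t → ∀ α : S → ZMod 2, X S α = integralSolution f S α)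

end MinOnes

/-! ### Decoding -/

/-- `c` is a codeword of the code with parity-check graph `B`. -/
def IsCodeword {n m : ℕ} (B : ParityCheckGraph n m) (c : Fin n → ZMod 2) : Prop :=
  ∀ j : Fin m, ∑ v ∈ B j, c v = 0

/-- The Nearest Codeword instance of the received vector `s`. The variables indicate which bits are
flipped; the constraint of check `j` is of odd type if `s` violates the check and of even type
otherwise. -/
def nearestCodeword {n m : ℕ} (B : ParityCheckGraph n m) (s : Fin n → ZMod 2) :
    CSPInstance (Fin n) (ZMod 2) (Fin m) where
  scope := B
  pred j α :=
    if ∑ v ∈ B j, s v = 1 then Odd #{v : B j | α v = 1} else Even #{v : B j | α v = 1}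

/-- The decoder based on `t` rounds of Sherali-Adams succeeds when `c` is transmitted and `s` is
received: the flip pattern `s + c` that turns `s` into `c` is the unique optimum of the
relaxation. -/
def SADecodes {n m : ℕ} (B : ParityCheckGraph n m) (t : ℕ) (s c : Fin n → ZMod 2) : Prop :=
  IsUniqueSAOptimum (nearestCodeword B s) t (s + c)

/-- `1 / (dc - 3)` for odd `dc` and `1 / (dc - 4)` for even `dc` (real subtraction). -/
def saBias (dc : ℕ) : ℝ := if Odd dc then 1 / ((dc : ℝ) - 3) else 1 / ((dc : ℝ) - 4)

/-- The lower bound for `⌊η n⌋` rounds on random `(dv, dc)`-LDPC codes. With high probability, for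
every received vector there is a feasible solution all of whose one-variable marginals, and hence
whose value, equal `saBias dc`; and the decoder fails whenever at least a `saBias dc` fraction of
the bits of the transmitted codeword has been corrupted. -/
def SALowerBound (dv dc : ℕ) (η : ℝ) : Prop :=
  WithHighProbability dv dc fun n _ B => ∀ s : Fin n → ZMod 2,
    (∃ X : (S : Finset (Fin n)) → (S → ZMod 2) → ℝ,
      IsSAFeasible (nearestCodeword B s) ⌊η * n⌋₊ X ∧
        (∀ v : Fin n, probOne X v = saBias dc) ∧ saValue X = saBias dc) ∧
    ∀ c : Fin n → ZMod 2, IsCodeword B c →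
      saBias dc ≤ (hammingDist c s : ℝ) / (n : ℝ) → ¬ SADecodes B ⌊η * n⌋₊ s c

end SALDPC

end

/-!
Let `b = saBias dc`, and weight the assignments `x : V → ZMod 2` by the product Bernoulli(`b`)
distribution `ν`. The solution of the relaxation is a reweighting of `ν` by pairwise independent
densities, one for each check.

*Densities.* If `b` is the given bias and `k` is `dc` or `dc - 2`, there is for either parity a law
on the weights `0, …, k` of that parity with the first two moments of the binomial distribution
(`exists_isParityWeightLaw`). Spread uniformly over the assignments of each weight, it is a
distribution on the neighbours of a check that satisfies the check and agrees with `ν` on any two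
bits. Its density `f j` with respect to `ν` therefore has no influence on sets of bits that meet the
neighbourhood `N j` in at most two places (`IsPairwiseDensity`).

*Closures.* A set `D` of checks is tight over a set `S` of variables if each check of `D` has three
neighbours in `S` or among the neighbours of the rest of `D`. Tight sets are closed under unions,
and expansion forces `|D| ≤ 4/3 |S|` for tight sets of moderate size, so there is a largest one,
`tightClosure S`. Put `X_S(α) = E_ν[1{x extends α} ∏ f j]` with the product over this closure. Any
larger moderate set of checks contains one that can be peeled off without changing the law on `S`
(`sum_prod_eq_of_subset`), so the marginals are consistent. A check is tight over its own
neighbourhood, so all constraints hold; no check is tight over a single variable, so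
`X_{v}(1) = b`.

*Expansion.* With high probability every set `D` of at most `κ n` checks touches at least
`(dc - 9/8) |D|` variables (`withHighProbability_of_expands`): for `s` checks the union bound gives
`(C (s / n) ^ (1/8)) ^ s`, and these terms have a sum tending to `0`. Counting the sockets whose
variable is not shared then bounds tight sets (`Expands.hasSmallTightSets`), and applied to one check
it shows `|N j| = dc` or `|N j| = dc - 2`.

*Decoding.* If the flip pattern has relative weight at least `b`, the solution `X` has at most its
value, but it is not integral because `0 < b < 1`.
-/

noncomputable section

namespace SALDPC

/-! ### Symmetric distributions on bits -/

section Symmetric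

variable {ι : Type*} [Fintype ι]

/-- The Hamming weight of a 0/1 assignment. -/
def weight (y : ι → ZMod 2) : ℕ := #{i | y i = 1}

/-- The value of a bit as a real number. -/
def bit (a : ZMod 2) : ℝ := if a = 1 then 1 else 0

/-- The density of the product distribution in which every bit is `1` with probability `b`. -/
def bernoulliWeight (b : ℝ) (y : ι → ZMod 2) : ℝ := ∏ i, if y i = 1 then b else 1 - b

lemma zmod_two_cases (a : ZMod 2) : a = 0 ∨ a = 1 := by
  revert a; decide

lemma sum_zmod_two (f : ZMod 2 → ℝ) : ∑ a, f a = f 0 + f 1 := Fin.sum_univ_two f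

lemma weight_eq_sum_bit (y : ι → ZMod 2) : (weight y : ℝ) = ∑ i, bit (y i) := by
  simp [weight, bit, Finset.sum_boole]

lemma weight_comp_equiv {κ : Type*} [Fintype κ] (e : κ ≃ ι) (y : ι → ZMod 2) :
    weight (y ∘ e) = weight y := by
  unfold weight
  exact Finset.card_bij (fun i _ => e i) (by simp) (by simp) (by
    intro i hi
    exact ⟨e.symm i, by simpa using hi, by simp⟩)

lemma sum_weight_apply [DecidableEq ι] (F : ℕ → ℝ) :
    ∑ y : ι → ZMod 2, F (weight y) =
      ∑ w ∈ range (Fintype.card ι + 1), ((Fintype.card ι).choose w : ℝ) * F w := by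
  have h := Finset.sum_powerset_apply_card F (x := (univ : Finset ι))
  simp only [Finset.powerset_univ, Finset.card_univ, nsmul_eq_mul] at h
  rw [← h]
  refine Finset.sum_bij' (fun y _ => ({i | y i = 1} : Finset ι))
    (fun s _ i => if i ∈ s then (1 : ZMod 2) else 0) (by simp) (by simp) ?_ ?_ ?_
  · intro y _
    funext i
    rcases zmod_two_cases (y i) with h | h <;> simp [h]
  · intro s _
    ext i
    simp
  · intro y _
    rfl

lemma sum_bernoulliWeight_mul_prod_bit [DecidableEq ι] (b : ℝ) (T : Finset ι) :
    ∑ y : ι → ZMod 2, bernoulliWeight b y * ∏ i ∈ T, bit (y i) = b ^ #T := by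
  have h1 : ∀ y : ι → ZMod 2, bernoulliWeight b y * ∏ i ∈ T, bit (y i) =
      ∏ i, (if y i = 1 then b else 1 - b) * (if i ∈ T then bit (y i) else 1) := by
    intro y
    rw [Finset.prod_mul_distrib, bernoulliWeight]
    congr 1
    simp [Finset.prod_ite_mem]
  simp_rw [h1]
  have h2 := Finset.prod_univ_sum (fun _ : ι => (univ : Finset (ZMod 2)))
    (fun i a => (if a = 1 then b else 1 - b) * (if i ∈ T then bit a else 1))
  rw [Fintype.piFinset_univ] at h2
  rw [← h2]
  have h3 : ∀ i : ι, ∑ a : ZMod 2, (if a = 1 then b else 1 - b) * (if i ∈ T then bit a else 1)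
      = if i ∈ T then b else 1 := by
    intro i
    rw [sum_zmod_two]
    by_cases h : i ∈ T <;> simp [h, bit]
  simp_rw [h3]
  simp [Finset.prod_ite_mem]

lemma sum_bernoulliWeight [DecidableEq ι] (b : ℝ) :
    ∑ y : ι → ZMod 2, bernoulliWeight b y = 1 := by
  simpa using sum_bernoulliWeight_mul_prod_bit (ι := ι) b ∅

lemma bernoulliWeight_pos {b : ℝ} (h0 : 0 < b) (h1 : b < 1) (y : ι → ZMod 2) :
    0 < bernoulliWeight b y := by
  unfold bernoulliWeight
  refine Finset.prod_pos fun i _ => ?_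
  split_ifs <;> linarith

/-- Transposing two bits does not change the weight. -/
lemma sum_swap_invariant [DecidableEq ι] (F : ℕ → ℝ) (φ : (ι → ZMod 2) → ℝ) (i j : ι) :
    ∑ y : ι → ZMod 2, F (weight y) * φ (y ∘ Equiv.swap i j) =
      ∑ y : ι → ZMod 2, F (weight y) * φ y := by
  refine Fintype.sum_equiv ((Equiv.swap i j).arrowCongr (Equiv.refl _)) _ _ fun y => ?_
  have : (((Equiv.swap i j).arrowCongr (Equiv.refl (ZMod 2))) y) = y ∘ Equiv.swap i j := by
    ext k; simp [Equiv.arrowCongr]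
  rw [this, weight_comp_equiv]

lemma card_mul_sum_bit [DecidableEq ι] (F : ℕ → ℝ) (i : ι) :
    (Fintype.card ι : ℝ) * ∑ y : ι → ZMod 2, F (weight y) * bit (y i) =
      ∑ y : ι → ZMod 2, F (weight y) * weight y := by
  simp_rw [weight_eq_sum_bit, Finset.mul_sum]
  rw [← Finset.mul_sum, Finset.sum_comm]
  have : ∀ j : ι, ∑ y : ι → ZMod 2, F (weight y) * bit (y j) =
      ∑ y : ι → ZMod 2, F (weight y) * bit (y i) := by
    intro j
    have := sum_swap_invariant F (fun y => bit (y i)) i j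
    simpa using this
  simp_rw [this]
  simp

lemma card_mul_sum_bit_mul_bit [DecidableEq ι] (F : ℕ → ℝ) {i j : ι} (hij : i ≠ j) :
    (Fintype.card ι : ℝ) * ((Fintype.card ι : ℝ) - 1) *
        ∑ y : ι → ZMod 2, F (weight y) * (bit (y i) * bit (y j)) =
      ∑ y : ι → ZMod 2, F (weight y) * (weight y * ((weight y : ℝ) - 1)) := by
  have h1 : ∀ l ∈ univ.erase i, ∑ y : ι → ZMod 2, F (weight y) * (bit (y i) * bit (y l)) =
      ∑ y : ι → ZMod 2, F (weight y) * (bit (y i) * bit (y j)) := by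
    intro l hl
    have := sum_swap_invariant F (fun y => bit (y i) * bit (y j)) j l
    have hli : l ≠ i := by simpa using hl
    simpa [Equiv.swap_apply_of_ne_of_ne hij hli.symm] using this
  have h2 := Finset.sum_congr rfl h1
  rw [Finset.sum_const, Finset.card_erase_of_mem (mem_univ i), Finset.card_univ, nsmul_eq_mul,
    Nat.cast_sub (Fintype.card_pos_iff.2 ⟨i⟩), Nat.cast_one, Finset.sum_comm] at h2
  have h3 := card_mul_sum_bit (fun w => F w * ((w : ℝ) - 1)) i
  rw [mul_assoc, ← h2]
  have h4 : ∀ y : ι → ZMod 2, ∑ l ∈ univ.erase i, F (weight y) * (bit (y i) * bit (y l)) =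
      F (weight y) * ((weight y : ℝ) - 1) * bit (y i) := by
    intro y
    rw [← Finset.mul_sum, ← Finset.mul_sum, mul_assoc]
    congr 1
    have : (weight y : ℝ) = bit (y i) + ∑ l ∈ univ.erase i, bit (y l) := by
      rw [weight_eq_sum_bit, Finset.add_sum_erase _ (fun l => bit (y l)) (mem_univ i)]
    rw [this]
    unfold bit
    split_ifs <;> simp
  simp_rw [h4, h3]
  exact Finset.sum_congr rfl fun y _ => by ring

/-- A function of at most two bits is an affine combination of `1`, the two bits and their product,
so its average is determined by the mean and the second moment of the weight whenever the
distribution is symmetric. -/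
lemma sum_mul_eq_of_dependsOn [DecidableEq ι] {b : ℝ} (hι : 2 ≤ Fintype.card ι) (F : ℕ → ℝ)
    (h0 : ∑ y : ι → ZMod 2, F (weight y) = 1)
    (h1 : ∑ y : ι → ZMod 2, F (weight y) * weight y = Fintype.card ι * b)
    (h2 : ∑ y : ι → ZMod 2, F (weight y) * (weight y * ((weight y : ℝ) - 1)) =
      Fintype.card ι * ((Fintype.card ι : ℝ) - 1) * b ^ 2)
    (A : Finset ι) (hA : #A ≤ 2) (h : (ι → ZMod 2) → ℝ) (hh : DependsOn h A) :
    ∑ y : ι → ZMod 2, F (weight y) * h y = ∑ y : ι → ZMod 2, bernoulliWeight b y * h y := by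
  obtain ⟨A', hAA', hA'⟩ := Finset.exists_superset_card_eq hA hι
  obtain ⟨i, j, hij, rfl⟩ := Finset.card_eq_two.1 hA'
  have hk : (2 : ℝ) ≤ Fintype.card ι := by exact_mod_cast hι
  set e : ZMod 2 → ZMod 2 → ℝ := fun a c => h fun v => if v = i then a else c
  have hform : ∀ y, h y = e 0 0 + (e 1 0 - e 0 0) * bit (y i) + (e 0 1 - e 0 0) * bit (y j) +
      (e 1 1 - e 1 0 - e 0 1 + e 0 0) * (bit (y i) * bit (y j)) := by
    intro y
    have : h y = e (y i) (y j) := by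
      refine hh fun v hv => ?_
      have := hAA' hv
      rw [mem_insert, mem_singleton] at this
      rcases this with rfl | rfl
      · simp
      · simp [hij.symm]
    rw [this]
    rcases zmod_two_cases (y i) with hi | hi <;> rcases zmod_two_cases (y j) with hj | hj <;>
      rw [hi, hj] <;> simp [bit]
    ring
  have hsum : ∀ G : (ι → ZMod 2) → ℝ, ∑ y, G y * h y = e 0 0 * ∑ y, G y +
      (e 1 0 - e 0 0) * ∑ y, G y * bit (y i) + (e 0 1 - e 0 0) * ∑ y, G y * bit (y j) +
      (e 1 1 - e 1 0 - e 0 1 + e 0 0) * ∑ y, G y * (bit (y i) * bit (y j)) := by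
    intro G
    simp_rw [Finset.mul_sum, ← Finset.sum_add_distrib]
    refine Finset.sum_congr rfl fun y _ => ?_
    rw [hform y]
    ring
  have hF1 : ∀ l : ι, ∑ y : ι → ZMod 2, F (weight y) * bit (y l) = b := by
    intro l
    have := card_mul_sum_bit F l
    rw [h1] at this
    exact mul_left_cancel₀ (by linarith) this
  have hF2 : ∑ y : ι → ZMod 2, F (weight y) * (bit (y i) * bit (y j)) = b ^ 2 := by
    have := card_mul_sum_bit_mul_bit F hij
    rw [h2] at this
    exact mul_left_cancel₀ (mul_pos (by linarith) (by linarith)).ne' this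
  have hB1 : ∀ l : ι, ∑ y : ι → ZMod 2, bernoulliWeight b y * bit (y l) = b := by
    intro l
    simpa using sum_bernoulliWeight_mul_prod_bit b ({l} : Finset ι)
  have hB2 : ∑ y : ι → ZMod 2, bernoulliWeight b y * (bit (y i) * bit (y j)) = b ^ 2 := by
    simpa [Finset.prod_pair hij, Finset.card_pair hij] using
      sum_bernoulliWeight_mul_prod_bit b ({i, j} : Finset ι)
  rw [hsum, hsum, h0, hF1, hF1, hF2, sum_bernoulliWeight, hB1, hB1, hB2]

end Symmetric

/-! ### Weight distributions with given parity -/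

/-- `p` is the law of a random weight in `{0, …, k}` of parity `r` whose first two factorial moments
are those of the binomial distribution with parameters `k` and `b`. -/
structure IsParityWeightLaw (k : ℕ) (b : ℝ) (r : Prop) (p : ℕ → ℝ) : Prop where
  nonneg : ∀ w, 0 ≤ p w
  parity : ∀ w, p w ≠ 0 → (Odd w ↔ r)
  total : ∑ w ∈ range (k + 1), p w = 1
  mean : ∑ w ∈ range (k + 1), p w * w = k * b
  second : ∑ w ∈ range (k + 1), p w * (w * ((w : ℝ) - 1)) = k * ((k : ℝ) - 1) * b ^ 2

lemma exists_isParityWeightLaw_of_masses {k : ℕ} {b : ℝ} {r : Prop} (u v w : ℕ) (P Q R : ℝ)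
    (hu : u ≤ k) (hv : v ≤ k) (hw : w ≤ k) (hur : Odd u ↔ r) (hvr : Odd v ↔ r) (hwr : Odd w ↔ r)
    (hP : 0 ≤ P) (hQ : 0 ≤ Q) (hR : 0 ≤ R) (h0 : P + Q + R = 1)
    (h1 : P * u + Q * v + R * w = k * b)
    (h2 : P * (u * ((u : ℝ) - 1)) + Q * (v * ((v : ℝ) - 1)) + R * (w * ((w : ℝ) - 1)) =
      k * ((k : ℝ) - 1) * b ^ 2) : ∃ p, IsParityWeightLaw k b r p := by
  have key : ∀ φ : ℕ → ℝ, ∑ x ∈ range (k + 1), ((if x = u then P else 0) +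
      (if x = v then Q else 0) + (if x = w then R else 0)) * φ x = P * φ u + Q * φ v + R * φ w := by
    intro φ
    simp only [add_mul, Finset.sum_add_distrib, ite_mul, zero_mul, Finset.sum_ite_eq', mem_range]
    rw [if_pos (by omega), if_pos (by omega), if_pos (by omega)]
  refine ⟨fun x => (if x = u then P else 0) + (if x = v then Q else 0) + (if x = w then R else 0),
    ?_, ?_, ?_, ?_, ?_⟩
  · intro x
    split_ifs <;> linarith
  · intro x hx
    by_cases hxu : x = u
    · rwa [hxu]
    by_cases hxv : x = v
    · rwa [hxv]
    by_cases hxw : x = w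
    · rwa [hxw]
    simp [hxu, hxv, hxw] at hx
  · simpa [h0] using key fun _ => 1
  · rw [key fun x => (x : ℝ), h1]
  · rw [key fun x => (x : ℝ) * ((x : ℝ) - 1), h2]

/-- A law on three prescribed weights exists as soon as the three Lagrange masses are
nonnegative. -/
lemma exists_isParityWeightLaw_of_lagrange {k : ℕ} {b : ℝ} {r : Prop} (u v w : ℕ)
    (huv : u < v) (hvw : v < w) (hw : w ≤ k)
    (hur : Odd u ↔ r) (hvr : Odd v ↔ r) (hwr : Odd w ↔ r)
    (hP : 0 ≤ k * b * ((k - 1) * b + 1 - v - w) + v * w)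
    (hQ : k * b * ((k - 1) * b + 1 - u - w) + u * w ≤ 0)
    (hR : 0 ≤ k * b * ((k - 1) * b + 1 - u - v) + u * v) : ∃ p, IsParityWeightLaw k b r p := by
  have h1 : (0 : ℝ) < v - u := sub_pos.2 (by exact_mod_cast huv)
  have h2 : (0 : ℝ) < w - v := sub_pos.2 (by exact_mod_cast hvw)
  have h3 : (0 : ℝ) < w - u := by linarith
  refine exists_isParityWeightLaw_of_masses (k := k) (b := b) u v w
    ((k * b * ((k - 1) * b + 1 - v - w) + v * w) / ((v - u) * (w - u)))
    (-(k * b * ((k - 1) * b + 1 - u - w) + u * w) / ((v - u) * (w - v)))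
    ((k * b * ((k - 1) * b + 1 - u - v) + u * v) / ((w - u) * (w - v)))
    (by omega) (by omega) hw hur hvr hwr
    (div_nonneg hP (by positivity)) (div_nonneg (by linarith) (by positivity))
    (div_nonneg hR (by positivity)) ?_ ?_ ?_
  all_goals
    field_simp
    ring

/-- Clears the denominator `d ^ 2`, which is `1 / b ^ 2` where this is used. -/
lemma nonneg_of_mul_sq_eq {E N d : ℝ} (hd : 0 < d) (h : E * d ^ 2 = N) (hN : 0 ≤ N) : 0 ≤ E :=
  nonneg_of_mul_nonneg_left (h ▸ hN) (by positivity)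

lemma nonpos_of_mul_sq_eq {E N d : ℝ} (hd : 0 < d) (h : E * d ^ 2 = -N) (hN : 0 ≤ N) : E ≤ 0 := by
  have := nonneg_of_mul_sq_eq (E := -E) hd (by rw [neg_mul, h, neg_neg]) hN
  linarith

/-- In this boundary case two weights suffice: `0` and `2`, or `1` and `k`. -/
lemma exists_isParityWeightLaw_sub_one {k : ℕ} (hk : 3 ≤ k) (hodd : Odd k) (r : Prop) :
    ∃ p, IsParityWeightLaw k (1 / ((k : ℝ) - 1)) r p := by
  obtain ⟨t, rfl⟩ := Nat.exists_eq_add_of_le' hk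
  have ht : (0 : ℝ) ≤ t := t.cast_nonneg
  have hb : (1 : ℝ) / (((t + 3 : ℕ) : ℝ) - 1) = 1 / (t + 2) := by push_cast; ring_nf
  rw [hb]
  by_cases hr : r
  · refine exists_isParityWeightLaw_of_masses 1 (t + 3) (t + 3)
      (1 - 1 / (t + 2) ^ 2) (1 / (t + 2) ^ 2) 0 (by omega) le_rfl le_rfl
      (by simp [hr]) (by simp [hr, hodd]) (by simp [hr, hodd]) ?_ (by positivity) le_rfl
      (by ring) ?_ ?_
    · rw [sub_nonneg, div_le_one (by positivity)]
      nlinarith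
    · push_cast; field_simp; ring
    · push_cast; field_simp; ring
  · refine exists_isParityWeightLaw_of_masses 0 2 2
      ((t + 1) / (2 * (t + 2))) ((t + 3) / (2 * (t + 2))) 0 (by omega) (by omega) (by omega)
      (by simp [hr]) (by simp [hr]) (by simp [hr]) (by positivity) (by positivity) le_rfl ?_ ?_ ?_
    all_goals
      push_cast; field_simp; ring

/-- The weights are `0`, `2`, `4` or `1`, `3`, `k`. -/
lemma exists_isParityWeightLaw_sub_three {k : ℕ} (hk : 5 ≤ k) (hodd : Odd k) (r : Prop) :
    ∃ p, IsParityWeightLaw k (1 / ((k : ℝ) - 3)) r p := by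
  obtain ⟨t, rfl⟩ := Nat.exists_eq_add_of_le' hk
  have ht : (0 : ℝ) ≤ t := t.cast_nonneg
  have h2 : (0 : ℝ) < t + 2 := by positivity
  have hb : (1 : ℝ) / (((t + 5 : ℕ) : ℝ) - 3) = 1 / (t + 2) := by push_cast; ring_nf
  rw [hb]
  by_cases hr : r
  · refine exists_isParityWeightLaw_of_lagrange 1 3 (t + 5) (by omega) (by omega) le_rfl
      (by simp [hr]) (by simp [hr]; decide) (by simp [hr, hodd])
      (nonneg_of_mul_sq_eq (N := (t + 5) * (2 * t ^ 2 + 4 * t + 2)) h2 ?_ (by positivity))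
      (nonpos_of_mul_sq_eq (N := (t + 5) * (2 * t + 2)) h2 ?_ (by positivity))
      (nonneg_of_mul_sq_eq (N := t ^ 2 + 2) h2 ?_ (by positivity))
    all_goals
      push_cast; field_simp; ring
  · refine exists_isParityWeightLaw_of_lagrange 0 2 4 (by omega) (by omega) (by omega)
      (by simp [hr]) (by simp [hr]) (by simp [hr]; decide)
      (nonneg_of_mul_sq_eq (N := 4 * t ^ 2 + 6 * t + 2) h2 ?_ (by positivity))
      (nonpos_of_mul_sq_eq (N := (t + 5) * (2 * t + 2)) h2 ?_ (by positivity))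
      (nonneg_of_mul_sq_eq (N := 2 * (t + 5)) h2 ?_ (by positivity))
    all_goals
      push_cast; field_simp; ring

/-- The weights are `0`, `2`, `4` or `1`, `3`, `k - 1`. -/
lemma exists_isParityWeightLaw_sub_two {k : ℕ} (hk : 4 ≤ k) (heven : Even k) (r : Prop) :
    ∃ p, IsParityWeightLaw k (1 / ((k : ℝ) - 2)) r p := by
  obtain ⟨t, rfl⟩ := Nat.exists_eq_add_of_le' hk
  have ht : (0 : ℝ) ≤ t := t.cast_nonneg
  have h2 : (0 : ℝ) < t + 2 := by positivity
  have hb : (1 : ℝ) / (((t + 4 : ℕ) : ℝ) - 2) = 1 / (t + 2) := by push_cast; ring_nf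
  rw [hb]
  by_cases hr : r
  · -- For `k = 4` the weights `3` and `k - 1` coincide, and weights `1` and `3` suffice.
    rcases Nat.eq_zero_or_pos t with rfl | htpos
    · exact exists_isParityWeightLaw_of_masses 1 3 3 (1 / 2) (1 / 2) 0 (by omega) (by omega)
        (by omega) (by simp [hr]) (by simp [hr]; decide) (by simp [hr]; decide) (by norm_num)
        (by norm_num) le_rfl (by norm_num) (by norm_num) (by norm_num)
    have hodd : Odd (t + 3) := by
      rw [show t + 4 = (t + 3) + 1 by ring, Nat.even_add_one, Nat.not_even_iff_odd] at heven
      exact heven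
    refine exists_isParityWeightLaw_of_lagrange 1 3 (t + 3) (by omega) (by omega) (by omega)
      (by simp [hr]) (by simp [hr]; decide) (by simp [hr, hodd])
      (nonneg_of_mul_sq_eq (N := 2 * t ^ 3 + 11 * t ^ 2 + 17 * t + 8) h2 ?_ (by positivity))
      (nonpos_of_mul_sq_eq (N := (t + 3) * t) h2 ?_ (by positivity))
      (nonneg_of_mul_sq_eq (N := t ^ 2 + t) h2 ?_ (by positivity))
    all_goals
      push_cast; field_simp; ring
  · refine exists_isParityWeightLaw_of_lagrange 0 2 4 (by omega) (by omega) (by omega)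
      (by simp [hr]) (by simp [hr]) (by simp [hr]; decide)
      (nonneg_of_mul_sq_eq (N := 4 * t ^ 2 + 9 * t + 4) h2 ?_ (by positivity))
      (nonpos_of_mul_sq_eq (N := (t + 4) * (2 * t + 3)) h2 ?_ (by positivity))
      (nonneg_of_mul_sq_eq (N := t + 4) h2 ?_ (by positivity))
    all_goals
      push_cast; field_simp; ring

/-- The weights are `0`, `2`, `4` or `1`, `3`, `k - 1`. -/
lemma exists_isParityWeightLaw_sub_four {k : ℕ} (hk : 6 ≤ k) (heven : Even k) (r : Prop) :
    ∃ p, IsParityWeightLaw k (1 / ((k : ℝ) - 4)) r p := by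
  obtain ⟨t, rfl⟩ := Nat.exists_eq_add_of_le' hk
  have ht : (0 : ℝ) ≤ t := t.cast_nonneg
  have h2 : (0 : ℝ) < t + 2 := by positivity
  have hb : (1 : ℝ) / (((t + 6 : ℕ) : ℝ) - 4) = 1 / (t + 2) := by push_cast; ring_nf
  rw [hb]
  by_cases hr : r
  · have hodd : Odd (t + 5) := by
      rw [show t + 6 = (t + 5) + 1 by ring, Nat.even_add_one, Nat.not_even_iff_odd] at heven
      exact heven
    refine exists_isParityWeightLaw_of_lagrange 1 3 (t + 5) (by omega) (by omega) (by omega)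
      (by simp [hr]) (by simp [hr]; decide) (by simp [hr, hodd])
      (nonneg_of_mul_sq_eq (N := 2 * t ^ 3 + 13 * t ^ 2 + 15 * t + 6) h2 ?_ (by positivity))
      (nonpos_of_mul_sq_eq (N := (t + 5) * (3 * t + 2)) h2 ?_ (by positivity))
      (nonneg_of_mul_sq_eq (N := t ^ 2 - t + 6) h2 ?_ (by nlinarith [sq_nonneg ((t : ℝ) - 1)]))
    all_goals
      push_cast; field_simp; ring
  · refine exists_isParityWeightLaw_of_lagrange 0 2 4 (by omega) (by omega) (by omega)
      (by simp [hr]) (by simp [hr]) (by simp [hr]; decide)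
      (nonneg_of_mul_sq_eq (N := 4 * t ^ 2 + 3 * t + 2) h2 ?_ (by positivity))
      (nonpos_of_mul_sq_eq (N := (t + 6) * (2 * t + 1)) h2 ?_ (by positivity))
      (nonneg_of_mul_sq_eq (N := 3 * (t + 6)) h2 ?_ (by positivity))
    all_goals
      push_cast; field_simp; ring

/-- The bias `saBias dc` is chosen so that it works for both arities that occur in a random code:
`dc`, and `dc - 2` when two edges of a check cancel. -/
lemma exists_isParityWeightLaw {dc k : ℕ} (hdc : 5 ≤ dc) (hk : k = dc ∨ k + 2 = dc) (r : Prop) :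
    ∃ p, IsParityWeightLaw k (saBias dc) r p := by
  unfold saBias
  rcases Nat.even_or_odd dc with hpar | hpar
  · rw [if_neg (Nat.not_odd_iff_even.2 hpar)]
    have h6 : 6 ≤ dc := by
      rcases hpar with ⟨q, rfl⟩; omega
    rcases hk with rfl | rfl
    · exact exists_isParityWeightLaw_sub_four h6 hpar r
    · have := exists_isParityWeightLaw_sub_two (k := k) (by omega)
        (by simpa [Nat.even_add] using hpar) r
      convert this using 3
      push_cast; ring
  · rw [if_pos hpar]
    rcases hk with rfl | rfl
    · exact exists_isParityWeightLaw_sub_three hdc hpar r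
    · have := exists_isParityWeightLaw_sub_one (k := k) (by omega)
        (by simpa [Nat.odd_add] using hpar) r
      convert this using 3
      push_cast; ring

lemma saBias_pos {dc : ℕ} (hdc : 5 ≤ dc) : 0 < saBias dc := by
  have : (5 : ℝ) ≤ dc := by exact_mod_cast hdc
  unfold saBias
  split_ifs <;> exact one_div_pos.2 (by linarith)

lemma saBias_lt_one {dc : ℕ} (hdc : 5 ≤ dc) : saBias dc < 1 := by
  unfold saBias
  split_ifs with h
  · have : (5 : ℝ) ≤ dc := by exact_mod_cast hdc
    rw [div_lt_one (by linarith)]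
    linarith
  · have h6 : 6 ≤ dc := by
      rcases Nat.not_odd_iff_even.1 h with ⟨q, rfl⟩; omega
    have : (6 : ℝ) ≤ dc := by exact_mod_cast h6
    rw [div_lt_one (by linarith)]
    linarith

/-! ### Pairwise independent densities -/

section Density

variable {V : Type*} [Fintype V] [DecidableEq V]

/-- `f` is a density with respect to the product Bernoulli distribution that depends on the bits in
`B` only and that has no influence on the joint law of any set of bits meeting `B` in at most two
places. -/
structure IsPairwiseDensity (b : ℝ) (B : Finset V) (f : (V → ZMod 2) → ℝ) : Prop where
  nonneg : ∀ x, 0 ≤ f x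
  dependsOn : DependsOn f B
  neutral : ∀ (A : Finset V) (g : (V → ZMod 2) → ℝ), DependsOn g A → #(B ∩ A) ≤ 2 →
    ∑ x, bernoulliWeight b x * (f x * g x) = ∑ x, bernoulliWeight b x * g x

lemma sum_bernoulliWeight_mul_eq_sum_sum (b : ℝ) (B : Finset V) (Φ : (V → ZMod 2) → ℝ) :
    ∑ x, bernoulliWeight b x * Φ x = ∑ z : {v // v ∉ B} → ZMod 2, bernoulliWeight b z *
      ∑ y : B → ZMod 2, bernoulliWeight b y *
        Φ ((Equiv.piEquivPiSubtypeProd (· ∈ B) fun _ => ZMod 2).symm (y, z)) := by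
  rw [← (Equiv.piEquivPiSubtypeProd (· ∈ B) fun _ => ZMod 2).symm.sum_comp,
    Fintype.sum_prod_type, Finset.sum_comm]
  refine Finset.sum_congr rfl fun z _ => ?_
  rw [Finset.mul_sum]
  refine Finset.sum_congr rfl fun y _ => ?_
  rw [← mul_assoc]
  congr 1
  rw [mul_comm]
  unfold bernoulliWeight
  rw [← Fintype.prod_subtype_mul_prod_subtype (· ∈ B)]
  congr 1
  · refine Finset.prod_bij (fun i _ => i) (by simp) (by simp) (by simp) fun i _ => ?_
    simp [Equiv.piEquivPiSubtypeProd, i.2]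
  · exact Finset.prod_congr rfl fun i _ => by simp [Equiv.piEquivPiSubtypeProd, i.2]

/-- A parity weight law, spread uniformly over the assignments of each weight, is pairwise
independent; its density is supported on the assignments of the given parity. -/
lemma exists_isPairwiseDensity {b : ℝ} (h0 : 0 < b) (h1 : b < 1) {B : Finset V} (hB : 2 ≤ #B)
    {r : Prop} {p : ℕ → ℝ} (hp : IsParityWeightLaw #B b r p) :
    ∃ f, IsPairwiseDensity b B f ∧
      ∀ x, ¬ (Odd (weight fun v : B => x v) ↔ r) → f x = 0 := by
  set F : ℕ → ℝ := fun w => p w / (#B).choose w with hF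
  have hsum : ∀ φ : ℕ → ℝ, ∑ y : B → ZMod 2, F (weight y) * φ (weight y) =
      ∑ w ∈ range (#B + 1), p w * φ w := by
    intro φ
    rw [sum_weight_apply (fun w => F w * φ w), Fintype.card_coe]
    refine Finset.sum_congr rfl fun w hw => ?_
    have : ((#B).choose w : ℝ) ≠ 0 := by
      have := Nat.choose_pos (Nat.lt_succ_iff.1 (mem_range.1 hw))
      positivity
    rw [hF]
    field_simp
  have hpair := sum_mul_eq_of_dependsOn (ι := B) (b := b) (by simpa using hB) F
    (by simpa [hp.total] using hsum fun _ => 1)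
    (by rw [hsum fun w => (w : ℝ), hp.mean, Fintype.card_coe])
    (by rw [hsum fun w => (w : ℝ) * ((w : ℝ) - 1), hp.second, Fintype.card_coe])
  refine ⟨fun x => F (weight fun v : B => x v) / bernoulliWeight b fun v : B => x v,
    ⟨?_, ?_, ?_⟩, ?_⟩
  · intro x
    exact div_nonneg (div_nonneg (hp.nonneg _) (Nat.cast_nonneg _))
      (bernoulliWeight_pos h0 h1 _).le
  · intro x y hxy
    have : (fun v : B => x v) = fun v : B => y v := funext fun v => hxy v v.2
    simp only [this]
  · intro A g hg hA
    rw [sum_bernoulliWeight_mul_eq_sum_sum b B, sum_bernoulliWeight_mul_eq_sum_sum b B]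
    refine Finset.sum_congr rfl fun z _ => ?_
    congr 1
    set G : (B → ZMod 2) → ℝ :=
      fun y => g ((Equiv.piEquivPiSubtypeProd (· ∈ B) fun _ => ZMod 2).symm (y, z)) with hG
    have hGA : DependsOn G ({v : B | v.1 ∈ A} : Finset B) := by
      intro y y' hyy
      refine hg fun v hv => ?_
      by_cases hvB : v ∈ B
      · simpa [Equiv.piEquivPiSubtypeProd, hvB] using hyy ⟨v, hvB⟩ (by simpa using hv)
      · simp [Equiv.piEquivPiSubtypeProd, hvB]
    have hcard : #({v : B | v.1 ∈ A} : Finset B) ≤ 2 := by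
      refine le_trans ?_ hA
      refine Finset.card_le_card_of_injOn Subtype.val ?_ Subtype.val_injective.injOn
      intro v hv
      simpa using hv
    rw [← hpair _ hcard G hGA]
    refine Finset.sum_congr rfl fun y _ => ?_
    have hy : (fun v : B => (Equiv.piEquivPiSubtypeProd (· ∈ B) fun _ => ZMod 2).symm (y, z) v.1)
        = y := by
      funext v
      simp [Equiv.piEquivPiSubtypeProd]
    rw [hy]
    have := (bernoulliWeight_pos h0 h1 y).ne'
    field_simp
    rfl
  · intro x hx
    have : p (weight fun v : B => x v) = 0 := by
      by_contra hne
      exact hx (hp.parity _ hne)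
    simp [hF, this]

end Density

/-! ### Tight sets of checks and closures -/

section Closure

variable {V ι : Type*} [DecidableEq V] [DecidableEq ι]

/-- A set `D` of checks is tight over the set `S` of variables if no check of `D` can be peeled off:
each has at least three neighbours in `S` or among the neighbours of the other checks of `D`. -/
def IsTight (N : ι → Finset V) (S : Finset V) (D : Finset ι) : Prop :=
  ∀ j ∈ D, 3 ≤ #(N j ∩ (S ∪ (D.erase j).biUnion N))

lemma isTight_empty (N : ι → Finset V) (S : Finset V) : IsTight N S ∅ := by
  simp [IsTight]

lemma IsTight.mono_left {N : ι → Finset V} {S T : Finset V} {D : Finset ι}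
    (hD : IsTight N S D) (h : S ⊆ T) : IsTight N T D := by
  intro j hj
  exact (hD j hj).trans (card_le_card (inter_subset_inter_left (union_subset_union_left h)))

lemma IsTight.union {N : ι → Finset V} {S : Finset V} {D E : Finset ι}
    (hD : IsTight N S D) (hE : IsTight N S E) : IsTight N S (D ∪ E) := by
  intro j hj
  rcases mem_union.1 hj with h | h
  · exact (hD j h).trans (card_le_card (inter_subset_inter_left (union_subset_union_right
      (biUnion_subset_biUnion_of_subset_left _ (erase_subset_erase _ subset_union_left)))))
  · exact (hE j h).trans (card_le_card (inter_subset_inter_left (union_subset_union_right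
      (biUnion_subset_biUnion_of_subset_left _ (erase_subset_erase _ subset_union_right)))))

/-- Tight sets of checks of moderate size are small. This is what expansion provides: at most
`4 / 3` checks per variable of `S`, for sets of at most `K` checks. -/
def HasSmallTightSets (N : ι → Finset V) (K : ℕ) : Prop :=
  ∀ (S : Finset V) (D : Finset ι), #D ≤ K → IsTight N S D → 3 * #D ≤ 4 * #S

variable [Fintype ι]

open Classical in
/-- The union of all tight sets over `S` with at most `K` checks. -/
def tightClosure (N : ι → Finset V) (K : ℕ) (S : Finset V) : Finset ι :=
  ({D : Finset ι | #D ≤ K ∧ IsTight N S D} : Finset (Finset ι)).biUnion id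

lemma subset_tightClosure {N : ι → Finset V} {K : ℕ} {S : Finset V} {D : Finset ι}
    (hK : #D ≤ K) (hD : IsTight N S D) : D ⊆ tightClosure N K S := by
  classical
  exact Finset.subset_biUnion_of_mem (u := id) (by simp [hK, hD])

/-- Two small tight sets have a small tight union, so the closure is itself the largest small tight
set. -/
lemma tightClosure_isTight {N : ι → Finset V} {t : ℕ} (hN : HasSmallTightSets N (3 * t))
    {S : Finset V} (hS : #S ≤ t) :
    IsTight N S (tightClosure N (3 * t) S) ∧ 3 * #(tightClosure N (3 * t) S) ≤ 4 * #S := by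
  classical
  have key : ∀ 𝒟 : Finset (Finset ι), (∀ D ∈ 𝒟, #D ≤ 3 * t ∧ IsTight N S D) →
      IsTight N S (𝒟.biUnion id) ∧ 3 * #(𝒟.biUnion id) ≤ 4 * #S := by
    intro 𝒟
    induction 𝒟 using Finset.induction_on with
    | empty => exact fun _ => ⟨by simpa using isTight_empty N S, by simp⟩
    | insert D 𝒟 _ ih =>
      intro h
      obtain ⟨h1, h2⟩ := ih fun E hE => h E (mem_insert_of_mem hE)
      obtain ⟨h3, h4⟩ := h D (mem_insert_self _ _)
      have h5 := hN S D h3 h4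
      rw [Finset.biUnion_insert, id]
      have h6 := h4.union h1
      have h7 := Finset.card_union_le D (𝒟.biUnion id)
      exact ⟨h6, hN S _ (by omega) h6⟩
  exact key _ fun D hD => by simpa using hD

end Closure

/-! ### The local distribution -/

section LocalSolution

variable {V ι : Type*}

/-- The indicator of the event that `x` extends the partial assignment `α`. -/
def extendsInd {S : Finset V} (α : S → ZMod 2) (x : V → ZMod 2) : ℝ :=
  if ∀ v : S, x v = α v then 1 else 0

lemma extendsInd_nonneg {S : Finset V} (α : S → ZMod 2) (x : V → ZMod 2) :
    0 ≤ extendsInd α x := by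
  unfold extendsInd
  split_ifs <;> norm_num

lemma dependsOn_extendsInd {S : Finset V} (α : S → ZMod 2) : DependsOn (extendsInd α) S := by
  intro x y hxy
  unfold extendsInd
  have : (∀ v : S, x v = α v) ↔ ∀ v : S, y v = α v :=
    forall_congr' fun v => by rw [hxy v v.2]
  simp only [this]

variable [DecidableEq V]

lemma sum_extendsInd {S T : Finset V} (h : S ⊆ T) (α : S → ZMod 2) (x : V → ZMod 2) :
    ∑ γ : T → ZMod 2 with (∀ v : S, γ ⟨v.1, h v.2⟩ = α v), extendsInd γ x = extendsInd α x := by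
  rw [Finset.sum_filter, Finset.sum_eq_single fun v : T => x v]
  · simp [extendsInd]
  · intro γ _ hγ
    have : ¬ ∀ v : T, x v = γ v := fun hx => hγ (funext fun v => (hx v).symm)
    rw [extendsInd, if_neg this, ite_self]
  · simp

variable [Fintype V]

/-- The distribution on `S` obtained from the product Bernoulli distribution by reweighting with the
densities of the checks in `cl S`. -/
def localSolution (b : ℝ) (f : ι → (V → ZMod 2) → ℝ) (cl : Finset V → Finset ι)
    (S : Finset V) (α : S → ZMod 2) : ℝ :=
  ∑ x, bernoulliWeight b x * ((∏ j ∈ cl S, f j x) * extendsInd α x)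

lemma localSolution_nonneg {b : ℝ} (h0 : 0 < b) (h1 : b < 1) {N : ι → Finset V}
    {f : ι → (V → ZMod 2) → ℝ} (hf : ∀ j, IsPairwiseDensity b (N j) (f j))
    (cl : Finset V → Finset ι) (S : Finset V) (α : S → ZMod 2) :
    0 ≤ localSolution b f cl S α :=
  Finset.sum_nonneg fun x _ => mul_nonneg (bernoulliWeight_pos h0 h1 x).le
    (mul_nonneg (Finset.prod_nonneg fun j _ => (hf j).nonneg x) (extendsInd_nonneg α x))

variable [DecidableEq ι]

/-- Checks outside the closure can be peeled off one at a time, each meeting what remains in at most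
two variables, without changing the law of the bits in `S`. -/
lemma sum_prod_eq_of_subset {b : ℝ} {N : ι → Finset V} {f : ι → (V → ZMod 2) → ℝ}
    (hf : ∀ j, IsPairwiseDensity b (N j) (f j)) {S : Finset V} {C E : Finset ι}
    (hC : IsTight N S C) (hCE : C ⊆ E) (hmax : ∀ D, D ⊆ E → IsTight N S D → D ⊆ C)
    (α : S → ZMod 2) :
    ∑ x, bernoulliWeight b x * ((∏ j ∈ E, f j x) * extendsInd α x) =
      ∑ x, bernoulliWeight b x * ((∏ j ∈ C, f j x) * extendsInd α x) := by
  induction E using Finset.strongInduction with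
  | H E ih =>
    rcases eq_or_ne C E with rfl | hne
    · rfl
    -- By maximality of `C`, some check of `E` can be peeled off; it is not in the tight set `C`.
    have hE : ¬ IsTight N S E := fun hE => hne (hCE.antisymm (hmax E subset_rfl hE))
    simp only [IsTight, not_forall, not_le] at hE
    obtain ⟨j, hj, hcard⟩ := hE
    have hjC : j ∉ C := by
      intro hjC
      have h1 := hC j hjC
      have h2 : #(N j ∩ (S ∪ (C.erase j).biUnion N)) ≤ #(N j ∩ (S ∪ (E.erase j).biUnion N)) :=
        card_le_card (inter_subset_inter_left (union_subset_union_right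
          (biUnion_subset_biUnion_of_subset_left _ (erase_subset_erase _ hCE))))
      omega
    rw [← ih (E.erase j) (erase_ssubset hj)
      (fun i hi => mem_erase.2 ⟨fun h => hjC (h ▸ hi), hCE hi⟩)
      (fun D hD => hmax D (hD.trans (erase_subset _ _)))]
    rw [← (hf j).neutral (S ∪ (E.erase j).biUnion N)
      (fun x => (∏ i ∈ E.erase j, f i x) * extendsInd α x) ?_ (by omega)]
    · refine Finset.sum_congr rfl fun x _ => ?_
      rw [← Finset.mul_prod_erase E (fun i => f i x) hj]
      ring
    · intro x y hxy
      have h1 : extendsInd α x = extendsInd α y :=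
        dependsOn_extendsInd α fun v hv => hxy v (by
          rw [mem_coe] at hv ⊢
          exact mem_union_left _ hv)
      have h2 : ∏ i ∈ E.erase j, f i x = ∏ i ∈ E.erase j, f i y :=
        Finset.prod_congr rfl fun i hi => (hf i).dependsOn fun v hv => hxy v (by
          rw [mem_coe] at hv ⊢
          exact mem_union_right _ (mem_biUnion.2 ⟨i, hi, hv⟩))
      simp only [h1, h2]

variable [Fintype ι]

/-- The closure over a subset is contained in the closure over the larger set, and the larger one
peels down to the smaller one; hence marginals are consistent. -/
lemma localSolution_marginal {b : ℝ} {N : ι → Finset V} {f : ι → (V → ZMod 2) → ℝ}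
    (hf : ∀ j, IsPairwiseDensity b (N j) (f j)) {t : ℕ} (hN : HasSmallTightSets N (3 * t))
    {S T : Finset V} (h : S ⊆ T) (hT : #T ≤ t) (α : S → ZMod 2) :
    ∑ γ : T → ZMod 2 with (∀ v : S, γ ⟨v.1, h v.2⟩ = α v),
        localSolution b f (tightClosure N (3 * t)) T γ =
      localSolution b f (tightClosure N (3 * t)) S α := by
  have hS : #S ≤ t := (card_le_card h).trans hT
  obtain ⟨hS1, hS2⟩ := tightClosure_isTight hN hS
  obtain ⟨hT1, hT2⟩ := tightClosure_isTight hN hT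
  unfold localSolution
  rw [Finset.sum_comm]
  simp_rw [← Finset.mul_sum, sum_extendsInd h α]
  refine sum_prod_eq_of_subset hf hS1 (subset_tightClosure (by omega) (hS1.mono_left h)) ?_ α
  intro D hD hDS
  exact subset_tightClosure ((card_le_card hD).trans (by omega)) hDS

lemma localSolution_empty {b : ℝ} {N : ι → Finset V} {f : ι → (V → ZMod 2) → ℝ} {t : ℕ}
    (hN : HasSmallTightSets N (3 * t)) (α : (∅ : Finset V) → ZMod 2) :
    localSolution b f (tightClosure N (3 * t)) ∅ α = 1 := by
  have h := (tightClosure_isTight hN (S := (∅ : Finset V)) (by simp)).2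
  have h0 : tightClosure N (3 * t) ∅ = ∅ := by
    rw [← Finset.card_eq_zero]
    simpa using h
  unfold localSolution
  rw [h0]
  simp [extendsInd, sum_bernoulliWeight]

lemma isLocalDistribution_localSolution {b : ℝ} (h0 : 0 < b) (h1 : b < 1) {N : ι → Finset V}
    {f : ι → (V → ZMod 2) → ℝ} (hf : ∀ j, IsPairwiseDensity b (N j) (f j)) {t : ℕ}
    (hN : HasSmallTightSets N (3 * t)) :
    IsLocalDistribution t (localSolution b f (tightClosure N (3 * t))) where
  mem_Icc S hS α := by
    refine ⟨localSolution_nonneg h0 h1 hf _ S α, ?_⟩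
    rw [← localSolution_empty hN (b := b) (f := f) (fun v => (notMem_empty _ v.2).elim),
      ← localSolution_marginal hf hN (empty_subset S) hS]
    exact Finset.single_le_sum (fun γ _ => localSolution_nonneg h0 h1 hf _ S γ)
      (mem_filter.2 ⟨mem_univ α, fun v => (notMem_empty _ v.2).elim⟩)
  empty := localSolution_empty hN
  marginal _ _ h hT α := localSolution_marginal hf hN h hT α

/-- No check is tight over a single variable, so one-variable marginals are the Bernoulli ones. -/
lemma probOne_localSolution {b : ℝ} {N : ι → Finset V}
    {f : ι → (V → ZMod 2) → ℝ} {t : ℕ} (ht : 1 ≤ t) (hN : HasSmallTightSets N (3 * t)) (v : V) :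
    probOne (localSolution b f (tightClosure N (3 * t))) v = b := by
  obtain ⟨h1, h2⟩ := tightClosure_isTight hN (S := {v}) (by simpa using ht)
  have hcl : tightClosure N (3 * t) {v} = ∅ := by
    by_contra hne
    obtain ⟨j, hj⟩ := Finset.nonempty_iff_ne_empty.2 hne
    -- The bound `3 |D| ≤ 4 |S|` with `|S| = 1` leaves room for one check only.
    have hone : #(tightClosure N (3 * t) {v}) = 1 := by
      have := Finset.card_pos.2 ⟨j, hj⟩
      rw [card_singleton] at h2
      omega
    have h3 := h1 j hj
    have h4 : (tightClosure N (3 * t) {v}).erase j = ∅ := by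
      rw [← Finset.card_eq_zero, card_erase_of_mem hj, hone]
    rw [h4, biUnion_empty, union_empty] at h3
    have h5 := card_le_card (inter_subset_right (s₁ := N j) (s₂ := {v}))
    rw [card_singleton] at h5
    omega
  unfold probOne localSolution
  rw [hcl]
  have := sum_bernoulliWeight_mul_prod_bit b ({v} : Finset V)
  simpa [extendsInd, bit] using this

/-- A check with at least three neighbours is tight over its own neighbourhood, so its density enters
the distribution there and enforces its constraint. -/
lemma localSolution_scope_eq_zero {b : ℝ} {N : ι → Finset V} {f : ι → (V → ZMod 2) → ℝ} {t : ℕ}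
    (ht : 1 ≤ t) {j : ι} (hj : 3 ≤ #(N j)) {α : N j → ZMod 2}
    (hα : ∀ x : V → ZMod 2, (∀ v : N j, x v = α v) → f j x = 0) :
    localSolution b f (tightClosure N (3 * t)) (N j) α = 0 := by
  have hmem : j ∈ tightClosure N (3 * t) (N j) := by
    refine subset_tightClosure (D := {j}) (by rw [card_singleton]; omega) ?_ (mem_singleton_self j)
    intro i hi
    rw [mem_singleton] at hi
    subst hi
    rw [inter_eq_left.2 subset_union_left]
    exact hj
  refine Finset.sum_eq_zero fun x _ => ?_
  by_cases hx : ∀ v : N j, x v = α v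
  · rw [Finset.prod_eq_zero hmem (hα x hx)]
    simp
  · rw [extendsInd, if_neg hx]
    simp

end LocalSolution

/-! ### Expansion bounds tight sets -/

section Expansion

variable {V ι : Type*} [Fintype V] [DecidableEq V] [DecidableEq ι] {d : ℕ}

/-- The neighbours of a check, read off from the map `w` that sends each check socket to the
variable it is matched with. -/
def oddNeighbors (w : ι × Fin d → V) (j : ι) : Finset V := {v | Odd #{i | w (j, i) = v}}

/-- Every set `D` of at most `K` checks touches at least `(d - 9 / 8) |D|` variables. -/
def Expands (w : ι × Fin d → V) (K : ℕ) : Prop :=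
  ∀ D : Finset ι, #D ≤ K → 8 * d * #D ≤ 8 * #((D ×ˢ univ).image w) + 9 * #D

omit [DecidableEq ι] in
lemma exists_socket_of_mem_oddNeighbors {w : ι × Fin d → V} {j : ι} {v : V}
    (h : v ∈ oddNeighbors w j) : ∃ i, w (j, i) = v := by
  rw [oddNeighbors, mem_filter] at h
  obtain ⟨i, hi⟩ := Finset.card_pos.1 h.2.pos
  exact ⟨i, by simpa using hi⟩

/-- The sockets of the checks in `D` whose variable is touched by no other socket of `D`. -/
def uniqueSockets (w : ι × Fin d → V) (D : Finset ι) : Finset (ι × Fin d) :=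
  {p ∈ D ×ˢ univ | ∀ q ∈ D ×ˢ (univ : Finset (Fin d)), w q = w p → q = p}

omit [Fintype V] in
lemma uniqueSockets_subset (w : ι × Fin d → V) (D : Finset ι) :
    uniqueSockets w D ⊆ D ×ˢ univ := filter_subset _ _

omit [Fintype V] in
lemma injOn_uniqueSockets (w : ι × Fin d → V) (D : Finset ι) :
    Set.InjOn w (uniqueSockets w D) := by
  intro p hp q hq hpq
  rw [mem_coe, uniqueSockets, mem_filter] at hp hq
  exact hq.2 p hp.1 hpq

omit [Fintype V] in
/-- Every touched variable that is not touched uniquely uses up at least two sockets. -/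
lemma two_mul_card_image_le (w : ι × Fin d → V) (D : Finset ι) :
    2 * #((D ×ˢ univ).image w) ≤ d * #D + #(uniqueSockets w D) := by
  have h1 := Finset.card_eq_sum_card_fiberwise (s := D ×ˢ univ) (t := (D ×ˢ univ).image w)
    (f := w) (fun p hp => mem_image_of_mem w hp)
  have h2 := Finset.card_eq_sum_card_fiberwise (s := uniqueSockets w D)
    (t := (D ×ˢ univ).image w) (f := w)
    (fun p hp => mem_image_of_mem w (uniqueSockets_subset w D hp))
  rw [card_product, card_univ, Fintype.card_fin, mul_comm] at h1
  rw [h1, h2, ← Finset.sum_add_distrib, mul_comm, ← smul_eq_mul]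
  refine Finset.card_nsmul_le_sum _ _ _ fun v hv => ?_
  obtain ⟨p, hp, rfl⟩ := mem_image.1 hv
  have hpos : p ∈ ({q ∈ D ×ˢ univ | w q = w p} : Finset (ι × Fin d)) := by simp [hp]
  by_cases hu : p ∈ uniqueSockets w D
  · have h3 : 0 < #{q ∈ D ×ˢ univ | w q = w p} := Finset.card_pos.2 ⟨p, hpos⟩
    have h4 : 0 < #{q ∈ uniqueSockets w D | w q = w p} :=
      Finset.card_pos.2 ⟨p, by simp [hu]⟩
    omega
  · rw [uniqueSockets, mem_filter] at hu
    push Not at hu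
    obtain ⟨q, hq, hqp, hne⟩ := hu hp
    have h3 : 1 < #{q ∈ D ×ˢ univ | w q = w p} :=
      Finset.one_lt_card.2 ⟨p, hpos, q, mem_filter.2 ⟨hq, hqp⟩, hne.symm⟩
    omega

/-- In a tight set each check has at least three sockets that are shared or lead to `S`. -/
lemma IsTight.card_uniqueSockets_le {w : ι × Fin d → V} {S : Finset V} {D : Finset ι}
    (hD : IsTight (oddNeighbors w) S D) : #(uniqueSockets w D) + 3 * #D ≤ d * #D + #S := by
  have h1 : #{p ∈ uniqueSockets w D | w p ∈ S} ≤ #S :=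
    Finset.card_le_card_of_injOn w (fun p hp => (mem_filter.1 hp).2)
      ((injOn_uniqueSockets w D).mono (filter_subset _ _))
  have h2 : #{p ∈ uniqueSockets w D | w p ∉ S} + 3 * #D ≤ d * #D := by
    have h3 := Finset.card_eq_sum_card_fiberwise (s := {p ∈ uniqueSockets w D | w p ∉ S})
      (t := D) (f := Prod.fst)
      (fun p hp => (mem_product.1 (uniqueSockets_subset w D (mem_filter.1 hp).1)).1)
    rw [h3, mul_comm 3, mul_comm d, ← smul_eq_mul, ← smul_eq_mul, ← Finset.sum_const,
      ← Finset.sum_const, ← Finset.sum_add_distrib]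
    refine Finset.sum_le_sum fun j hj => ?_
    set good : Finset (ι × Fin d) := {p ∈ {p ∈ uniqueSockets w D | w p ∉ S} | p.1 = j} with hgood
    have hsub : good ⊆ {j} ×ˢ univ := by
      intro p hp
      exact mem_product.2 ⟨mem_singleton.2 (mem_filter.1 hp).2, mem_univ _⟩
    have hcard : #(({j} ×ˢ univ) \ good) + #good = d := by
      rw [Finset.card_sdiff_add_card_eq_card hsub, card_product]
      simp
    -- A neighbour in `S` or shared with another check of `D` occupies a socket that is not good.
    have h4 : oddNeighbors w j ∩ (S ∪ (D.erase j).biUnion (oddNeighbors w)) ⊆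
        (({j} ×ˢ univ) \ good).image w := by
      intro v hv
      rw [mem_inter, mem_union, mem_biUnion] at hv
      obtain ⟨i, hi⟩ := exists_socket_of_mem_oddNeighbors hv.1
      refine mem_image.2 ⟨(j, i), mem_sdiff.2 ⟨by simp, fun hg => ?_⟩, hi⟩
      rw [hgood, mem_filter, mem_filter, uniqueSockets, mem_filter] at hg
      rcases hv.2 with hS | ⟨j', hj', hv'⟩
      · exact hg.1.2 (hi ▸ hS)
      · obtain ⟨i', hi'⟩ := exists_socket_of_mem_oddNeighbors hv'
        have := hg.1.1.2 (j', i') (by simp [(mem_erase.1 hj').2]) (hi'.trans hi.symm)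
        exact (mem_erase.1 hj').1 (congrArg Prod.fst this)
    have h5 := (hD j hj).trans ((card_le_card h4).trans card_image_le)
    omega
  have h6 := Finset.card_filter_add_card_filter_not (s := uniqueSockets w D) (fun p => w p ∈ S)
  omega

lemma Expands.hasSmallTightSets {w : ι × Fin d → V} {K : ℕ} (hw : Expands w K) :
    HasSmallTightSets (oddNeighbors w) K := by
  intro S D hK hD
  have h1 := hw D hK
  have h2 := two_mul_card_image_le w D
  have h3 := hD.card_uniqueSockets_le
  rw [mul_assoc] at h1
  omega

/-- A single check loses at most two sockets to a double edge, and the number of its neighbours has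
the parity of the number of its sockets. -/
lemma Expands.card_oddNeighbors {w : ι × Fin d → V} {K : ℕ} (hw : Expands w K) (hK : 1 ≤ K)
    (j : ι) : #(oddNeighbors w j) = d ∨ #(oddNeighbors w j) + 2 = d := by
  have h1 := hw {j} (by simpa using hK)
  have h2 := two_mul_card_image_le w {j}
  have h3 : #(uniqueSockets w {j}) ≤ #(oddNeighbors w j) := by
    refine Finset.card_le_card_of_injOn w ?_ (injOn_uniqueSockets w {j})
    rintro ⟨j', i⟩ hp
    rw [mem_coe, uniqueSockets, mem_filter] at hp
    obtain rfl : j' = j := mem_singleton.1 (mem_product.1 hp.1).1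
    rw [mem_coe, oddNeighbors, mem_filter]
    refine ⟨mem_univ _, ?_⟩
    have : ({i' | w (j', i') = w (j', i)} : Finset (Fin d)) = {i} := by
      ext i'
      rw [mem_filter, mem_singleton]
      refine ⟨fun h => ?_, fun h => ⟨mem_univ _, by rw [h]⟩⟩
      exact congrArg Prod.snd (hp.2 (j', i') (by simp) h.2)
    rw [this]
    simp
  -- Modulo 2, the number of odd multiplicities is the sum of all multiplicities.
  have h4 : ∑ v, #{i | w (j, i) = v} = d := by
    rw [← Finset.card_eq_sum_card_fiberwise (fun _ _ => mem_univ _), card_univ, Fintype.card_fin]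
  have h5 := Finset.odd_sum_iff_odd_card_odd (s := univ) fun v => #{i | w (j, i) = v}
  rw [h4] at h5
  change Odd d ↔ Odd #(oddNeighbors w j) at h5
  have h6 : #(oddNeighbors w j) ≤ d := by
    refine le_trans (card_le_card (t := univ.image fun i => w (j, i)) ?_)
      (card_image_le.trans_eq (by simp))
    intro v hv
    obtain ⟨i, hi⟩ := exists_socket_of_mem_oddNeighbors hv
    exact mem_image.2 ⟨i, mem_univ _, hi⟩
  rw [card_singleton] at h1 h2
  rw [Nat.odd_iff, Nat.odd_iff] at h5
  omega

end Expansion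

lemma SocketMatching.graph_eq_oddNeighbors {n m dv dc : ℕ} (π : SocketMatching n m dv dc) :
    π.graph = oddNeighbors fun p => (π.symm p).1 := by
  funext j
  ext v
  have : #{a : Fin dv | (π (v, a)).1 = j} = #{i : Fin dc | (π.symm (j, i)).1 = v} := by
    refine Finset.card_bij' (fun a _ => (π (v, a)).2) (fun i _ => (π.symm (j, i)).2) ?_ ?_ ?_ ?_
    · rintro a ha
      obtain rfl : (π (v, a)).1 = j := by simpa using ha
      simp
    · rintro i hi
      obtain rfl : (π.symm (j, i)).1 = v := by simpa using hi
      simp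
    · rintro a ha
      obtain rfl : (π (v, a)).1 = j := by simpa using ha
      simp
    · rintro i hi
      obtain rfl : (π.symm (j, i)).1 = v := by simpa using hi
      simp
  simp [SocketMatching.graph, oddNeighbors, this]

/-! ### Random matchings expand -/

section Counting

variable {α β : Type*} [Fintype α] [Fintype β] [DecidableEq α] [DecidableEq β]

/-- The bijections that match all of `P` into `Q`. -/
def matchingsInto (P : Finset β) (Q : Finset α) : Finset (α ≃ β) :=
  {e | ∀ x ∈ P, e.symm x ∈ Q}

/-- Double counting of the pairs of a bijection matching `P` into `Q` and a further element matched
into `Q`: by symmetry under transpositions, every element outside `P` is equally likely to be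
matched into `Q`. -/
lemma card_matchingsInto_insert {P : Finset β} {Q : Finset α} {x : β} (hx : x ∉ P) :
    (Fintype.card β - #P) * #(matchingsInto (insert x P) Q) =
      (#Q - #P) * #(matchingsInto P Q) := by
  have hleft : ∀ y ∈ Pᶜ, #{e ∈ matchingsInto P Q | e.symm y ∈ Q} =
      #(matchingsInto (insert x P) Q) := by
    intro y hy
    rw [mem_compl] at hy
    have hfix : ∀ z ∈ P, Equiv.swap x y z = z := fun z hz =>
      Equiv.swap_apply_of_ne_of_ne (fun h => hx (h ▸ hz)) (fun h => hy (h ▸ hz))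
    refine Finset.card_bij' (fun e _ => e.trans (Equiv.swap x y))
      (fun e _ => e.trans (Equiv.swap x y)) ?_ ?_ ?_ ?_
    · intro e he
      simp only [matchingsInto, mem_filter, mem_univ, true_and] at he ⊢
      intro z hz
      rcases mem_insert.1 hz with rfl | hz
      · simpa using he.2
      · simpa [hfix z hz] using he.1 z hz
    · intro e he
      simp only [matchingsInto, mem_filter, mem_univ, true_and] at he ⊢
      refine ⟨fun z hz => ?_, ?_⟩
      · simpa [hfix z hz] using he z (mem_insert_of_mem hz)
      · simpa using he x (mem_insert_self x P)
    · intro e _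
      ext z
      simp
    · intro e _
      ext z
      simp
  have hright : ∀ e ∈ matchingsInto P Q, #{y ∈ Pᶜ | e.symm y ∈ Q} = #Q - #P := by
    intro e he
    simp only [matchingsInto, mem_filter, mem_univ, true_and] at he
    have h1 : ({y ∈ Pᶜ | e.symm y ∈ Q} : Finset β) = Q.map e.toEmbedding \ P := by
      ext y
      simp [and_comm]
    rw [h1, card_sdiff_of_subset, card_map]
    intro y hy
    simpa using he y hy
  have h := Finset.sum_card_bipartiteAbove_eq_sum_card_bipartiteBelow
    (s := Pᶜ) (t := matchingsInto P Q) (fun y e => e.symm y ∈ Q)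
  unfold Finset.bipartiteAbove Finset.bipartiteBelow at h
  rw [Finset.sum_congr rfl hleft, Finset.sum_congr rfl hright, Finset.sum_const, Finset.sum_const,
    card_compl, smul_eq_mul, smul_eq_mul] at h
  rw [h, mul_comm]

/-- The probability that all of `P` is matched into `Q` is at most `(|Q| / N) ^ |P|`, where `N` is
the number of elements on either side. -/
lemma card_matchingsInto_mul_pow_le (hcard : Fintype.card α = Fintype.card β)
    (P : Finset β) (Q : Finset α) :
    #(matchingsInto P Q) * Fintype.card β ^ #P ≤ #Q ^ #P * Fintype.card (α ≃ β) := by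
  induction P using Finset.induction_on with
  | empty => simpa using Finset.card_le_univ _
  | insert x P hx ih =>
    have h1 := card_matchingsInto_insert (Q := Q) hx
    have h2 : #P < Fintype.card β := by
      have := Finset.card_le_univ (insert x P)
      rw [card_insert_of_notMem hx] at this
      omega
    have h3 : #Q ≤ Fintype.card β := hcard ▸ Finset.card_le_univ Q
    set N := Fintype.card β
    have h4 : (#Q - #P) * N ≤ (N - #P) * #Q := by
      rw [Nat.sub_mul, Nat.sub_mul, mul_comm N]
      exact Nat.sub_le_sub_left (Nat.mul_le_mul_left _ h3) _
    rw [card_insert_of_notMem hx]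
    refine Nat.le_of_mul_le_mul_left ?_ (Nat.sub_pos_of_lt h2)
    calc (N - #P) * (#(matchingsInto (insert x P) Q) * N ^ (#P + 1))
        = (#Q - #P) * N * (#(matchingsInto P Q) * N ^ #P) := by
          rw [← mul_assoc, h1]; ring
      _ ≤ (N - #P) * #Q * (#Q ^ #P * Fintype.card (α ≃ β)) := Nat.mul_le_mul h4 ih
      _ = _ := by ring

end Counting

open Classical in
/-- Union bound: if a set of `s` checks touches too few variables, its sockets are matched into the
sockets of some set of exactly `⌊(dc - 9 / 8) s⌋` variables. -/
lemma card_not_expands_le {n m dv dc : ℕ} (h : n * dv = m * dc) (hdc : 2 ≤ dc) {K : ℕ}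
    (hK : dc * K ≤ n) :
    (#{π : SocketMatching n m dv dc | ¬ Expands (fun p => (π.symm p).1) K} : ℝ) ≤
      (∑ i ∈ range K, (m.choose (i + 1) : ℝ) * (n.choose ((8 * dc - 9) * (i + 1) / 8) : ℝ) *
        (((8 * dc - 9) * (i + 1) / 8 : ℕ) / n : ℝ) ^ (dc * (i + 1))) *
          Fintype.card (SocketMatching n m dv dc) := by
  set J : ℕ → ℕ := fun s => (8 * dc - 9) * s / 8 with hJ
  have hJs : ∀ s, 8 * J s ≤ (8 * dc - 9) * s := fun s => Nat.mul_div_le _ _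
  have hsub : ({π : SocketMatching n m dv dc | ¬ Expands (fun p => (π.symm p).1) K} :
      Finset (SocketMatching n m dv dc)) ⊆
      (range K).biUnion fun i => (powersetCard (i + 1) (univ : Finset (Fin m))).biUnion fun D =>
        (powersetCard (J (i + 1)) (univ : Finset (Fin n))).biUnion fun A =>
          matchingsInto (D ×ˢ (univ : Finset (Fin dc))) (A ×ˢ (univ : Finset (Fin dv))) := by
    intro π hπ
    rw [mem_filter, Expands] at hπ
    have hπ := hπ.2
    push Not at hπ
    obtain ⟨D, hDK, hD⟩ := hπ
    have hD0 : 0 < #D := by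
      rcases Nat.eq_zero_or_pos #D with h0 | h0
      · rw [h0] at hD
        omega
      · exact h0
    set Γ := (D ×ˢ (univ : Finset (Fin dc))).image fun p => (π.symm p).1 with hΓ
    have h1 : #Γ ≤ J #D := by
      rw [hJ, Nat.le_div_iff_mul_le (by norm_num), Nat.sub_mul]
      omega
    -- There is room for a set of exactly `J #D` variables, because `dc * K ≤ n`.
    have h2 : J #D ≤ Fintype.card (Fin n) := by
      rw [Fintype.card_fin]
      have h3 := hJs #D
      have h4 := Nat.mul_le_mul_left dc hDK
      rw [Nat.sub_mul, mul_assoc] at h3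
      omega
    obtain ⟨A, hΓA, hA⟩ := Finset.exists_superset_card_eq h1 h2
    simp only [mem_biUnion, mem_range, mem_powersetCard, subset_univ, true_and]
    refine ⟨#D - 1, by omega, D, by omega, A, by rw [hA]; congr; omega, ?_⟩
    rw [matchingsInto, mem_filter]
    refine ⟨mem_univ _, fun p hp => ?_⟩
    rw [mem_product]
    exact ⟨hΓA (mem_image_of_mem _ hp), mem_univ _⟩
  have hone : ∀ i ∈ range K, ∀ D ∈ powersetCard (i + 1) (univ : Finset (Fin m)),
      ∀ A ∈ powersetCard (J (i + 1)) (univ : Finset (Fin n)),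
      (#(matchingsInto (D ×ˢ (univ : Finset (Fin dc))) (A ×ˢ (univ : Finset (Fin dv)))) : ℝ) ≤
        ((J (i + 1) : ℝ) / n) ^ (dc * (i + 1)) * Fintype.card (SocketMatching n m dv dc) := by
    intro i hi D hD A hA
    have hD' := (mem_powersetCard.1 hD).2
    have hA' := (mem_powersetCard.1 hA).2
    have hm : 0 < m := by
      have := Finset.card_le_univ D
      rw [Fintype.card_fin] at this
      omega
    have hN : 0 < n * dv := h ▸ Nat.mul_pos hm (by omega)
    have hn : (0 : ℝ) < n := by exact_mod_cast Nat.pos_of_mul_pos_right hN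
    have hdv : (0 : ℝ) < dv := by exact_mod_cast Nat.pos_of_mul_pos_left hN
    have h1 := card_matchingsInto_mul_pow_le (by simpa using h)
      (D ×ˢ (univ : Finset (Fin dc))) (A ×ˢ (univ : Finset (Fin dv)))
    simp only [card_product, card_univ, Fintype.card_prod, Fintype.card_fin, hD', hA', ← h] at h1
    have h2 : (#(matchingsInto (D ×ˢ (univ : Finset (Fin dc))) (A ×ˢ (univ : Finset (Fin dv)))) : ℝ)
        * ((n : ℝ) * dv) ^ ((i + 1) * dc) ≤ ((J (i + 1) : ℝ) * dv) ^ ((i + 1) * dc) *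
          Fintype.card (SocketMatching n m dv dc) := by exact_mod_cast h1
    rw [← mul_div_mul_right _ _ hdv.ne', div_pow, div_mul_eq_mul_div, le_div_iff₀ (by positivity),
      mul_comm dc]
    exact h2
  have hcount : #{π : SocketMatching n m dv dc | ¬ Expands (fun p => (π.symm p).1) K} ≤
      ∑ i ∈ range K, ∑ D ∈ powersetCard (i + 1) (univ : Finset (Fin m)),
        ∑ A ∈ powersetCard (J (i + 1)) (univ : Finset (Fin n)),
          #(matchingsInto (D ×ˢ (univ : Finset (Fin dc))) (A ×ˢ (univ : Finset (Fin dv)))) := by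
    refine (card_le_card hsub).trans (card_biUnion_le.trans (sum_le_sum fun i _ => ?_))
    exact card_biUnion_le.trans (sum_le_sum fun D _ => card_biUnion_le)
  calc (#{π : SocketMatching n m dv dc | ¬ Expands (fun p => (π.symm p).1) K} : ℝ)
      ≤ ∑ i ∈ range K, ∑ D ∈ powersetCard (i + 1) (univ : Finset (Fin m)),
        ∑ A ∈ powersetCard (J (i + 1)) (univ : Finset (Fin n)),
          (#(matchingsInto (D ×ˢ (univ : Finset (Fin dc))) (A ×ˢ (univ : Finset (Fin dv)))) : ℝ) :=
        by exact_mod_cast hcount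
    _ ≤ ∑ i ∈ range K, ∑ D ∈ powersetCard (i + 1) (univ : Finset (Fin m)),
        ∑ A ∈ powersetCard (J (i + 1)) (univ : Finset (Fin n)),
          ((J (i + 1) : ℝ) / n) ^ (dc * (i + 1)) * Fintype.card (SocketMatching n m dv dc) :=
        sum_le_sum fun i hi => sum_le_sum fun D hD => sum_le_sum fun A hA => hone i hi D hD A hA
    _ = _ := by
        rw [Finset.sum_mul]
        refine Finset.sum_congr rfl fun i _ => ?_
        simp only [Finset.sum_const, card_powersetCard, card_univ, Fintype.card_fin, nsmul_eq_mul]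
        ring

/-! ### The union bound -/

/-- The constant `C` for which the union bound over sets of `s` checks is
`(C (dc s / n) ^ (1 / 8)) ^ s`. It depends on the variable degree only through a bound `L` on the
number of checks per variable. -/
def expansionBase (L : ℝ) (dc : ℕ) : ℝ := Real.exp (1 + dc) * L * dc

/-- The number of checks, relative to the block length, up to which sets of checks expand. It makes
the base of the `s`-th power in the union bound at most `1 / 4`. -/
def expansionFraction (L : ℝ) (dc : ℕ) : ℝ := (1 / (4 * expansionBase L dc)) ^ 8 / dc

lemma one_le_expansionBase {L : ℝ} (hL : 1 ≤ L) {dc : ℕ} (hdc : 1 ≤ dc) :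
    1 ≤ expansionBase L dc := by
  have h1 : (1 : ℝ) ≤ dc := by exact_mod_cast hdc
  have h2 : (1 : ℝ) ≤ Real.exp (1 + dc) := Real.one_le_exp (by positivity)
  exact one_le_mul_of_one_le_of_one_le (one_le_mul_of_one_le_of_one_le h2 hL) h1

lemma expansionFraction_pos {L : ℝ} (hL : 1 ≤ L) {dc : ℕ} (hdc : 1 ≤ dc) :
    0 < expansionFraction L dc := by
  have h1 := one_le_expansionBase hL hdc
  unfold expansionFraction
  positivity

lemma expansionFraction_mul_le_one {L : ℝ} (hL : 1 ≤ L) {dc : ℕ} (hdc : 1 ≤ dc) :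
    dc * expansionFraction L dc ≤ 1 := by
  have h1 := one_le_expansionBase hL hdc
  have h2 : (dc : ℝ) ≠ 0 := by positivity
  unfold expansionFraction
  rw [mul_div_cancel₀ _ h2]
  exact pow_le_one₀ (by positivity) (by rw [div_le_one (by positivity)]; linarith)

/-- The usual estimate of a binomial coefficient, from `s ^ s / s! ≤ exp s`. -/
lemma choose_le_exp_mul_div_pow {m s : ℕ} {M : ℝ} (hs : 1 ≤ s) (hm : (m : ℝ) ≤ M) :
    (m.choose s : ℝ) ≤ (Real.exp 1 * M / s) ^ s := by
  have hs' : (0 : ℝ) < s := by exact_mod_cast hs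
  have h1 := Nat.choose_le_pow_div (α := ℝ) s m
  have h2 := Real.pow_div_factorial_le_exp (s : ℝ) hs'.le s
  have h3 : (0 : ℝ) < s.factorial := by positivity
  rw [div_le_iff₀ h3] at h2
  rw [div_pow, mul_pow, ← Real.exp_nat_mul, mul_one, le_div_iff₀ (by positivity)]
  calc (m.choose s : ℝ) * s ^ s ≤ (m ^ s / s.factorial) * (Real.exp s * s.factorial) := by gcongr
    _ = Real.exp s * m ^ s := by field_simp
    _ ≤ Real.exp s * M ^ s := by gcongr

lemma choose_mul_div_pow_le_exp {n j : ℕ} (hn : 0 < n) :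
    (n.choose j : ℝ) * ((j : ℝ) / n) ^ j ≤ Real.exp j := by
  have hn' : (0 : ℝ) < n := by exact_mod_cast hn
  have h1 := Nat.choose_le_pow_div (α := ℝ) j n
  have h2 := Real.pow_div_factorial_le_exp (j : ℝ) j.cast_nonneg j
  calc (n.choose j : ℝ) * ((j : ℝ) / n) ^ j ≤ n ^ j / j.factorial * ((j : ℝ) / n) ^ j := by gcongr
    _ = (j : ℝ) ^ j / j.factorial := by rw [div_pow]; field_simp
    _ ≤ Real.exp j := h2

/-- The entropy of the choice of `s` checks and `j ≤ (dc - 9 / 8) s` variables is beaten by the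
probability that `dc s` sockets land there, with a factor `(s / n) ^ (1 / 8)` per check to spare. -/
lemma union_bound_term_le {L : ℝ} (hL : 1 ≤ L) {n m dc s j : ℕ} (hdc : 1 ≤ dc) (hs : 1 ≤ s)
    (hm : (m : ℝ) ≤ L * n) (hsn : (s : ℝ) ≤ expansionFraction L dc * n)
    (hj : 8 * j + 9 * s ≤ 8 * dc * s) :
    (m.choose s : ℝ) * (n.choose j : ℝ) * ((j : ℝ) / n) ^ (dc * s) ≤
      expansionBase L dc * ((dc : ℝ) / n) ^ (1 / 8 : ℝ) * (1 / 2) ^ (s - 1) := by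
  have hs' : (1 : ℝ) ≤ s := by exact_mod_cast hs
  have hdc' : (1 : ℝ) ≤ dc := by exact_mod_cast hdc
  have hC := one_le_expansionBase hL hdc
  have hκ := expansionFraction_pos hL hdc
  have hn : (0 : ℝ) < n := by
    by_contra h
    nlinarith
  have hn' : 0 < n := by exact_mod_cast hn
  set C := expansionBase L dc with hCdef
  -- An upper bound for `j / n`.
  set x : ℝ := dc * s / n with hx
  have hx0 : 0 < x := by positivity
  have hx1 : x ≤ (1 / (4 * C)) ^ 8 := by
    rw [hx, div_le_iff₀ hn]
    calc (dc : ℝ) * s ≤ dc * (expansionFraction L dc * n) := by gcongr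
      _ = (1 / (4 * C)) ^ 8 * n := by
        rw [expansionFraction, ← hCdef]
        field_simp
  have hx2 : x ≤ 1 :=
    hx1.trans (pow_le_one₀ (by positivity) (by rw [div_le_one (by positivity)]; linarith))
  have hjs : j ≤ dc * s := by
    rw [mul_assoc] at hj
    omega
  have h1 := choose_le_exp_mul_div_pow hs hm
  have h2 : (n.choose j : ℝ) * ((j : ℝ) / n) ^ j ≤ Real.exp dc ^ s := by
    refine (choose_mul_div_pow_le_exp hn').trans ?_
    rw [← Real.exp_nat_mul, Real.exp_le_exp, mul_comm]
    exact_mod_cast hjs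
  have h3 : ((j : ℝ) / n) ^ (dc * s - j) ≤ (x * x ^ (1 / 8 : ℝ)) ^ s := by
    have h4 : (j : ℝ) / n ≤ x := by
      rw [hx]
      gcongr
      exact_mod_cast hjs
    have h5 : x * x ^ (1 / 8 : ℝ) = x ^ (9 / 8 : ℝ) := by
      nth_rewrite 1 [← Real.rpow_one x]
      rw [← Real.rpow_add hx0]
      norm_num
    rw [h5, ← Real.rpow_natCast (x ^ (9 / 8 : ℝ)), ← Real.rpow_mul hx0.le]
    refine (pow_le_pow_left₀ (by positivity) h4 _).trans ?_
    rw [← Real.rpow_natCast]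
    refine Real.rpow_le_rpow_of_exponent_ge hx0 hx2 ?_
    rw [Nat.cast_sub hjs]
    have : (8 : ℝ) * j + 9 * s ≤ 8 * dc * s := by exact_mod_cast hj
    push_cast
    linarith
  have hz : C * x ^ (1 / 8 : ℝ) ≤ 1 / 4 := by
    have h4 : x ^ (1 / 8 : ℝ) ≤ 1 / (4 * C) := by
      have h5 := Real.rpow_le_rpow hx0.le hx1 (by norm_num : (0 : ℝ) ≤ 1 / 8)
      have h6 : (1 / 8 : ℝ) = (((8 : ℕ) : ℝ))⁻¹ := by norm_num
      rw [h6] at h5 ⊢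
      rwa [Real.pow_rpow_inv_natCast (by positivity) (by norm_num)] at h5
    calc C * x ^ (1 / 8 : ℝ) ≤ C * (1 / (4 * C)) := by gcongr
      _ = 1 / 4 := by field_simp
  have hzs : C * x ^ (1 / 8 : ℝ) ≤ C * ((dc : ℝ) / n) ^ (1 / 8 : ℝ) * s := by
    have h4 : x = (dc : ℝ) / n * s := by rw [hx]; ring
    rw [h4, Real.mul_rpow (by positivity) (by positivity), ← mul_assoc]
    gcongr
    exact Real.rpow_le_self_of_one_le hs' (by norm_num)
  -- Half of the decay `4 ^ (1 - s)` absorbs the factor `s`.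
  have hs2 : (s : ℝ) ≤ 2 ^ (s - 1) := by
    have : s - 1 < 2 ^ (s - 1) := Nat.lt_two_pow_self
    exact_mod_cast (by omega : s ≤ 2 ^ (s - 1))
  calc (m.choose s : ℝ) * (n.choose j : ℝ) * ((j : ℝ) / n) ^ (dc * s)
      = (m.choose s : ℝ) * ((n.choose j : ℝ) * ((j : ℝ) / n) ^ j) *
          ((j : ℝ) / n) ^ (dc * s - j) := by
        rw [← Nat.add_sub_cancel' hjs, pow_add, Nat.add_sub_cancel_left]
        ring
    _ ≤ (Real.exp 1 * (L * n) / s) ^ s * Real.exp dc ^ s * (x * x ^ (1 / 8 : ℝ)) ^ s := by gcongr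
    _ = (C * x ^ (1 / 8 : ℝ)) ^ s := by
        rw [← mul_pow, ← mul_pow]
        congr 1
        rw [hCdef, expansionBase, Real.exp_add, ← mul_assoc]
        congr 1
        rw [hx]
        field_simp
    _ = (C * x ^ (1 / 8 : ℝ)) * (C * x ^ (1 / 8 : ℝ)) ^ (s - 1) := by
        rw [← pow_succ', Nat.sub_add_cancel hs]
    _ ≤ (C * ((dc : ℝ) / n) ^ (1 / 8 : ℝ) * 2 ^ (s - 1)) * (1 / 4) ^ (s - 1) := by
        refine mul_le_mul (hzs.trans ?_) (pow_le_pow_left₀ (by positivity) hz _) (by positivity)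
          (by positivity)
        gcongr
    _ = _ := by
        rw [mul_assoc, ← mul_pow]
        norm_num

lemma one_sub_le_uniformProb {Ω : Type*} [Fintype Ω] [Nonempty Ω] {ε : ℝ} {Q P : Ω → Prop}
    [DecidablePred Q] (hQ : (#{ω | ¬ Q ω} : ℝ) ≤ ε * Fintype.card Ω) (hQP : ∀ ω, Q ω → P ω) :
    1 - ε ≤ uniformProb P := by
  classical
  have h0 : (0 : ℝ) < Fintype.card Ω := by exact_mod_cast Fintype.card_pos
  unfold uniformProb
  rw [Nat.card_eq_fintype_card, Nat.card_eq_fintype_card, le_div_iff₀ h0, Fintype.card_subtype]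
  have h1 : (#{ω | Q ω} : ℝ) ≤ #{ω | P ω} := by
    exact_mod_cast card_le_card (fun ω hω => by
      rw [mem_filter] at hω ⊢
      exact ⟨hω.1, hQP ω hω.2⟩)
  have h2 : (#{ω | Q ω} : ℝ) + #{ω | ¬ Q ω} = Fintype.card Ω := by
    exact_mod_cast Finset.card_filter_add_card_filter_not (s := (univ : Finset Ω)) Q
  linarith

lemma eventually_expansion_error_le (C : ℝ) (d : ℕ) {ε : ℝ} (hε : 0 < ε) :
    ∃ n₀ : ℕ, ∀ n : ℕ, n₀ ≤ n → C * ((d : ℝ) / n) ^ (1 / 8 : ℝ) * 2 ≤ ε := by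
  have h1 : Filter.Tendsto (fun n : ℕ => (d : ℝ) / n) Filter.atTop (nhds 0) :=
    tendsto_const_div_atTop_nhds_zero_nat _
  have h2 := ((h1.rpow_const (p := 1 / 8) (Or.inr (by norm_num))).const_mul C).mul_const 2
  rw [Real.zero_rpow (by norm_num), mul_zero, zero_mul] at h2
  obtain ⟨n₀, hn₀⟩ := Filter.eventually_atTop.1 (h2.eventually (eventually_le_nhds hε))
  exact ⟨n₀, hn₀⟩

/-- A property that follows from expansion up to a linear number of checks, for large block
lengths, holds with high probability. -/
lemma withHighProbability_of_expands {L : ℝ} (hL : 1 ≤ L) {dv dc : ℕ} (hdc : 2 ≤ dc)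
    (hdv : (dv : ℝ) ≤ L * dc) {K : ℕ → ℕ} (hK : ∀ n : ℕ, (K n : ℝ) ≤ expansionFraction L dc * n)
    {P : ∀ n m : ℕ, ParityCheckGraph n m → Prop} {n₁ : ℕ}
    (hP : ∀ (n m : ℕ) (w : Fin m × Fin dc → Fin n), n₁ ≤ n → Expands w (K n) →
      P n m (oddNeighbors w)) : WithHighProbability dv dc P := by
  classical
  intro ε hε
  have hdc1 : 1 ≤ dc := by omega
  obtain ⟨n₀, hn₀⟩ := eventually_expansion_error_le (expansionBase L dc) dc hε
  refine ⟨max n₀ n₁, fun n m hn h => ?_⟩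
  have hdc' : (0 : ℝ) < dc := by exact_mod_cast hdc1
  have hm : (m : ℝ) ≤ L * n := by
    have h1 : (n : ℝ) * dv = m * dc := by exact_mod_cast h
    refine le_of_mul_le_mul_right ?_ hdc'
    rw [← h1]
    calc (n : ℝ) * dv ≤ n * (L * dc) := by gcongr
      _ = L * n * dc := by ring
  have hKn : dc * K n ≤ n := by
    have : (dc : ℝ) * K n ≤ n := by
      calc (dc : ℝ) * K n ≤ dc * (expansionFraction L dc * n) := by gcongr; exact hK n
        _ = dc * expansionFraction L dc * n := by ring
        _ ≤ 1 * n := by gcongr; exact expansionFraction_mul_le_one hL hdc1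
        _ = n := one_mul _
    exact_mod_cast this
  have : Nonempty (SocketMatching n m dv dc) :=
    ⟨Fintype.equivOfCardEq (by simpa using h)⟩
  refine one_sub_le_uniformProb
    (Q := fun π : SocketMatching n m dv dc => Expands (fun p => (π.symm p).1) (K n)) ?_ ?_
  · refine (card_not_expands_le h hdc hKn).trans ?_
    gcongr
    refine le_trans (sum_le_sum fun i hi => union_bound_term_le hL hdc1 (by omega) hm ?_ ?_) ?_
    · refine le_trans ?_ (hK n)
      exact_mod_cast mem_range.1 hi
    · have := Nat.mul_div_le ((8 * dc - 9) * (i + 1)) 8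
      rw [Nat.sub_mul] at this ⊢
      have h9 : 9 * (i + 1) ≤ 8 * dc * (i + 1) := Nat.mul_le_mul_right _ (by omega)
      omega
    · simp only [Nat.add_sub_cancel]
      rw [← Finset.mul_sum]
      have hC := one_le_expansionBase hL hdc1
      refine le_trans ?_ (hn₀ n (le_of_max_le_left hn))
      gcongr
      exact sum_geometric_two_le _
  · intro π hπ
    rw [SocketMatching.graph_eq_oddNeighbors]
    exact hP n m _ (le_of_max_le_right hn) hπ

/-! ### The lower bound -/

/-- On an expanding graph all nearest codeword instances have a Sherali-Adams solution whose
one-variable marginals are constant. -/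
lemma exists_isSAFeasible {n m dc t : ℕ} (hdc : 5 ≤ dc) (ht : dc ≤ t) (htn : t ≤ n)
    {w : Fin m × Fin dc → Fin n} (hw : Expands w (3 * t)) (s : Fin n → ZMod 2) :
    ∃ X : (S : Finset (Fin n)) → (S → ZMod 2) → ℝ,
      IsSAFeasible (nearestCodeword (oddNeighbors w) s) t X ∧
        ∀ v : Fin n, probOne X v = saBias dc := by
  have hb0 := saBias_pos hdc
  have hb1 := saBias_lt_one hdc
  have hcard := hw.card_oddNeighbors (by omega)
  have hf : ∀ j : Fin m, ∃ f, IsPairwiseDensity (saBias dc) (oddNeighbors w j) f ∧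
      ∀ x, ¬ (Odd (weight fun v : oddNeighbors w j => x v) ↔ ∑ v ∈ oddNeighbors w j, s v = 1) →
        f x = 0 := by
    intro j
    obtain ⟨p, hp⟩ := exists_isParityWeightLaw hdc (hcard j) (∑ v ∈ oddNeighbors w j, s v = 1)
    have := hcard j
    exact exists_isPairwiseDensity hb0 hb1 (by omega) hp
  choose f hf hf0 using hf
  have hN := hw.hasSmallTightSets
  refine ⟨localSolution (saBias dc) f (tightClosure (oddNeighbors w) (3 * t)), ?_,
    probOne_localSolution (by omega) hN⟩
  refine ⟨by omega, by simpa using htn, fun j => ?_,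
    isLocalDistribution_localSolution hb0 hb1 hf hN, fun j α hα => ?_⟩
  · change #(oddNeighbors w j) ≤ t
    have := hcard j
    omega
  · have := hcard j
    refine localSolution_scope_eq_zero (N := oddNeighbors w) (by omega) (by omega)
      fun x hx => hf0 j x ?_
    have hxα : (fun v : oddNeighbors w j => x v) = α := funext hx
    rw [hxα]
    intro h
    refine hα ?_
    change if _ then Odd (weight α) else Even (weight α)
    split_ifs with hs
    · exact h.2 hs
    · exact Nat.not_odd_iff_even.1 fun ho => hs (h.1 ho)

lemma saValue_of_probOne_eq {n : ℕ} (hn : 0 < n)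
    {X : (S : Finset (Fin n)) → (S → ZMod 2) → ℝ} {b : ℝ} (hX : ∀ v, probOne X v = b) :
    saValue X = b := by
  have : (n : ℝ) ≠ 0 := by positivity
  simp [saValue, hX, this]

lemma saValue_integralSolution {n : ℕ} (s c : Fin n → ZMod 2) :
    saValue (integralSolution (s + c)) = (hammingDist c s : ℝ) / n := by
  unfold saValue hammingDist
  rw [Fintype.card_fin]
  congr 1
  rw [Finset.card_filter]
  push_cast
  refine Finset.sum_congr rfl fun v _ => ?_
  have : ∀ a b : ZMod 2, 1 = a + b ↔ b ≠ a := by decide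
  simp [probOne, integralSolution, this]

/-- A solution with fractional marginals whose value is at most that of the flip pattern prevents
the flip pattern from being the unique optimum. -/
lemma not_sADecodes {n m t : ℕ} (hn : 0 < n) (ht : 1 ≤ t) {B : ParityCheckGraph n m}
    {s c : Fin n → ZMod 2} {X : (S : Finset (Fin n)) → (S → ZMod 2) → ℝ}
    (hX : IsSAFeasible (nearestCodeword B s) t X) {b : ℝ} (hb0 : 0 < b) (hb1 : b < 1)
    (hXb : ∀ v, probOne X v = b) (hc : b ≤ (hammingDist c s : ℝ) / n) : ¬ SADecodes B t s c := by
  rintro ⟨-, hopt⟩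
  obtain ⟨h1, h2⟩ := hopt X hX
  have hval := saValue_of_probOne_eq hn hXb
  have heq : saValue X = saValue (integralSolution (s + c)) := by
    refine le_antisymm ?_ h1
    rw [hval, saValue_integralSolution]
    exact hc
  have h3 := h2 heq {⟨0, hn⟩} (by simpa using ht) fun _ => 1
  have h4 := hXb ⟨0, hn⟩
  rw [probOne, h3, integralSolution] at h4
  split_ifs at h4 <;> linarith

/-- The closures need expansion up to three times the number of rounds. -/
lemma sALowerBound_of_le {L : ℝ} (hL : 1 ≤ L) {dv dc : ℕ} (hdc : 5 ≤ dc)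
    (hdv : (dv : ℝ) ≤ L * dc) : SALowerBound dv dc (expansionFraction L dc / 3) := by
  set κ := expansionFraction L dc with hκdef
  have hκ : 0 < κ := expansionFraction_pos hL (by omega)
  have hκ1 : dc * κ ≤ 1 := expansionFraction_mul_le_one hL (by omega)
  have hdc' : (5 : ℝ) ≤ dc := by exact_mod_cast hdc
  have hfloor : ∀ n : ℕ, (⌊κ / 3 * n⌋₊ : ℝ) ≤ κ / 3 * n := fun n => Nat.floor_le (by positivity)
  refine withHighProbability_of_expands hL (by omega) hdv (K := fun n => 3 * ⌊κ / 3 * n⌋₊)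
    (n₁ := ⌈dc / (κ / 3)⌉₊) (fun n => ?_) ?_
  · push_cast
    have := hfloor n
    linarith
  · intro n m w hn hw s
    have hn' : dc / (κ / 3) ≤ n := (Nat.le_ceil _).trans (by exact_mod_cast hn)
    have ht : dc ≤ ⌊κ / 3 * n⌋₊ := by
      refine Nat.le_floor ?_
      rwa [div_le_iff₀' (by positivity)] at hn'
    have htn : ⌊κ / 3 * n⌋₊ ≤ n := by
      have h1 : κ / 3 ≤ 1 := by nlinarith
      have h2 : (⌊κ / 3 * n⌋₊ : ℝ) ≤ n :=
        (hfloor n).trans (mul_le_of_le_one_left n.cast_nonneg h1)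
      exact_mod_cast h2
    obtain ⟨X, hX, hXb⟩ := exists_isSAFeasible hdc ht htn hw s
    have hn0 : 0 < n := by omega
    exact ⟨⟨X, hX, hXb, saValue_of_probOne_eq hn0 hXb⟩, fun c _ hc =>
      not_sADecodes hn0 (by omega) hX (saBias_pos hdc) (saBias_lt_one hdc) hXb hc⟩

end SALDPC

end

/-- For `dv ≤ dc` (that is, `m ≤ n`) the constant `η` depends on `dc` only; for arbitrary `dv` it
may depend on `dv` as well. -/
theorem theorem1 (dc : ℕ) (hdc : 5 ≤ dc) :
    (∃ η : ℝ, 0 < η ∧ ∀ dv : ℕ, dv ≤ dc → SALDPC.SALowerBound dv dc η) ∧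
      ∀ dv : ℕ, ∃ η : ℝ, 0 < η ∧ SALDPC.SALowerBound dv dc η := by
  have hpos : ∀ L : ℝ, 1 ≤ L → 0 < SALDPC.expansionFraction L dc / 3 := fun L hL =>
    div_pos (SALDPC.expansionFraction_pos hL (by omega)) (by norm_num)
  refine ⟨⟨_, hpos 1 le_rfl, fun dv hdv => ?_⟩, fun dv => ⟨_, hpos (dv + 1) (by simp), ?_⟩⟩
  · exact SALDPC.sALowerBound_of_le le_rfl hdc (by rw [one_mul]; exact_mod_cast hdv)
  · refine SALDPC.sALowerBound_of_le (by simp) hdc ?_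
    have : (1 : ℝ) ≤ dc := by exact_mod_cast (by omega : 1 ≤ dc)
    have h0 : (0 : ℝ) ≤ dv := dv.cast_nonneg
    nlinarith
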